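/- Let $\alpha\in(0,2)$, $\lambda_+,\lambda_->0$, $\mu,\beta\in\mathbb R$ and $b>0$. For $\lambda,\lambda'>0$, $\mathrm{stdCTS}(\alpha,\lambda,\lambda')$ denotes the standardized classical tempered stable law, that is, the infinitely divisible law on $\mathbb R$ with mean $0$, no Gaussian part and Lévy measure $$\nu(dx)=\frac{e^{-\lambda x}x^{-1-\alpha}\mathbf 1_{\{x>0\}}+e^{-\lambda'|x|}|x|^{-1-\alpha}\mathbf 1_{\{x<0\}}}{\Gamma(2-\alpha)(\lambda^{\alpha-2}+\lambda'^{\alpha-2})}\,dx,$$ i.e. with characteristic function $\exp\int(e^{itx}-1-itx)\,\nu(dx)$. Let $$Y=\mu+\beta V+\sqrt V\,X$$ be mixed tempered stable: $V$ is a positive random variable and, conditionally on $V$, $X\sim\mathrm{stdCTS}(\alpha,\lambda_+\sqrt V,\lambda_-\sqrt V)$. For $u\in[-\lambda_-,\lambda_+]$ let $$\Phi_H(u)=\frac{(\lambda_+-u)^\alpha-\lambda_+^\alpha+(\lambda_-+u)^\alpha-\lambda_-^\alpha}{\alpha(\alpha-1)(\lambda_+^{\alpha-2}+\lambda_-^{\alpha-2})}+\frac{(\lambda_+^{\alpha-1}-\lambda_-^{\alpha-1})u}{(\alpha-1)(\lambda_+^{\alpha-2}+\lambda_-^{\alpha-2})}$$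 be the cumulant generating function of $H\sim\mathrm{stdCTS}(\alpha,\lambda_+,\lambda_-)$, where for $\alpha=1$ the right-hand side is understood as its limit $$\Phi_H(u)=\frac{(\lambda_+-u)\log\frac{\lambda_+-u}{\lambda_+}+(\lambda_-+u)\log\frac{\lambda_-+u}{\lambda_-}}{\lambda_+^{-1}+\lambda_-^{-1}}\qquad(0\log 0=0).$$ The fundamental strip of a real random variable $Z$ is the set of $u\in\mathbb C$ with $E[|e^{uZ}|]<\infty$. Suppose that $V$ has fundamental strip $\{\operatorname{Re}(u)<b\}$; this is the case, for example, if $V\sim\Gamma(a,b)$ with shape $a>0$ and rate $b$. Then: 1. If $\max\{-\beta\lambda_-+\Phi_H(-\lambda_-),\ \beta\lambda_++\Phi_H(\lambda_+)\}<b$, then $Y$ has fundamental strip $-\lambda_-\le\operatorname{Re}(u)\le\lambda_+$. 2. If $-\beta\lambda_-+\Phi_H(-\lambda_-)<b<\beta\lambda_++\Phi_H(\lambda_+)$, then the equation $\beta u+\Phi_H(u)=b$ has a unique real solution $u_+\in[-\lambda_-,\lambda_+]$, and $Y$ has fundamental strip $-\lambda_-\le\operatorname{Re}(u)<u_+$.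 3. If $-\beta\lambda_-+\Phi_H(-\lambda_-)>b>\beta\lambda_++\Phi_H(\lambda_+)$, then the equation $\beta u+\Phi_H(u)=b$ has a unique real solution $u_-\in[-\lambda_-,\lambda_+]$, and $Y$ has fundamental strip $u_-<\operatorname{Re}(u)\le\lambda_+$. 4. If $b<\min\{-\beta\lambda_-+\Phi_H(-\lambda_-),\ \beta\lambda_++\Phi_H(\lambda_+)\}$, then the equation $\beta u+\Phi_H(u)=b$ has exactly two real solutions $u_-<u_+$ in $[-\lambda_-,\lambda_+]$, and $Y$ has fundamental strip $u_-<\operatorname{Re}(u)<u_+$. -/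

import Mathlib

open MeasureTheory ProbabilityTheory

namespace MixedTS

noncomputable section

/-- The fundamental strip of a random variable `Z`: all `u ∈ ℂ` with `E[|e^{uZ}|] < ∞`. -/
def fundamentalStrip {Ω : Type*} [MeasurableSpace Ω] (P : Measure Ω) (Z : Ω → ℝ) : Set ℂ :=
  {u : ℂ | ∫⁻ ω, ‖Complex.exp (u * (Z ω : ℂ))‖ₑ ∂P < ⊤}

/-- The density of the Lévy measure of a classical tempered stable law with stability index `α`,
tempering parameters `lp` (right tail) and `lm` (left tail), and scales `cp`, `cm`. -/
def ctsLevyDensity (α lp lm cp cm x : ℝ) : ℝ :=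
  if 0 < x then cp * Real.exp (-lp * x) * x ^ (-1 - α)
  else if x < 0 then cm * Real.exp (-lm * |x|) * |x| ^ (-1 - α)
  else 0

/-- The Lévy–Khintchine exponent of the classical tempered stable law with mean `m`:
`i t m + ∫ (e^{itx} - 1 - itx) ν(dx)`. -/
def ctsCharExponent (α lp lm cp cm m t : ℝ) : ℂ :=
  Complex.I * (t : ℂ) * (m : ℂ) +
    ∫ x : ℝ, (Complex.exp (Complex.I * (t : ℂ) * (x : ℂ)) - 1 - Complex.I * (t : ℂ) * (x : ℂ))
      * (ctsLevyDensity α lp lm cp cm x : ℂ)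

/-- `ρ` is the classical tempered stable law `CTS(α, lp, lm, cp, cm, m)`: the infinitely divisible
law without Gaussian part, with mean `m` and the above Lévy measure (`0 < α < 2`). -/
def IsCTS (α lp lm cp cm m : ℝ) (ρ : Measure ℝ) : Prop :=
  IsProbabilityMeasure ρ ∧
    ∀ t : ℝ, charFun ρ t = Complex.exp (ctsCharExponent α lp lm cp cm m t)

/-- The scale that gives the law unit variance. -/
def stdScale (α lp lm : ℝ) : ℝ :=
  1 / (Real.Gamma (2 - α) * (lp ^ (α - 2) + lm ^ (α - 2)))

/-- `ρ` is the standardized classical tempered stable law `stdCTS(α, lp, lm)`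
(mean `0`, variance `1`). -/
def IsStdCTS (α lp lm : ℝ) (ρ : Measure ℝ) : Prop :=
  IsCTS α lp lm (stdScale α lp lm) (stdScale α lp lm) 0 ρ

/-- `Y = μ + β V + √V X` is mixed tempered stable, with mixing variable `V > 0` and
`X | V ∼ stdCTS(α, lp √V, lm √V)`. -/
structure IsMixedTS {Ω : Type*} [MeasurableSpace Ω] (P : Measure Ω) [IsProbabilityMeasure P]
    (μ β α lp lm : ℝ) (V X Y : Ω → ℝ) : Prop where
  measurable_V : Measurable V
  measurable_X : Measurable X
  pos_V : ∀ᵐ ω ∂P, 0 < V ω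
  cond_X : ∀ᵐ v ∂(P.map V), IsStdCTS α (lp * √v) (lm * √v) (condDistrib X V P v)
  eq_Y : ∀ᵐ ω ∂P, Y ω = μ + β * V ω + √(V ω) * X ω

/-- The cumulant generating function `Φ_H` of `H ∼ stdCTS(α, lp, lm)` at real `u ∈ [-lm, lp]`.
At `α = 1`, where the general expression reads `0 / 0`, it is its limit as `α → 1`
(`Real.log 0 = 0` gives the correct values at `u = lp` and `u = -lm`). -/
def PhiH (α lp lm u : ℝ) : ℝ :=
  if α = 1 then
    ((lp - u) * Real.log ((lp - u) / lp) + (lm + u) * Real.log ((lm + u) / lm))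
      / (lp⁻¹ + lm⁻¹)
  else
    ((lp - u) ^ α - lp ^ α + (lm + u) ^ α - lm ^ α)
        / (α * (α - 1) * (lp ^ (α - 2) + lm ^ (α - 2)))
      + (lp ^ (α - 1) - lm ^ (α - 1)) * u
        / ((α - 1) * (lp ^ (α - 2) + lm ^ (α - 2)))

/-- The real solutions of `β u + Φ_H(u) = b` in the domain `[-lm, lp]` of `Φ_H`. -/
def realSolutions (β α lp lm b : ℝ) : Set ℝ :=
  {u : ℝ | u ∈ Set.Icc (-lm) lp ∧ β * u + PhiH α lp lm u = b}

end

end MixedTS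

/-! Given `V = v`, tempering by `lp √v` and `lm √v` is exactly what makes the Lévy measure of `√v X`
equal to `v` times that of `H`. Hence `E[e^{s√v X} | V = v]` is `e^{v Φ_H(s)}` for `s ∈ [-lm, lp]`
and infinite elsewhere (`lintegral_exp_of_isStdCTS`). Integrating over `v` gives `E[e^{sY}] = e^{sμ}
E[e^{(βs + Φ_H(s))V}]` on `[-lm, lp]`, so `s` is in the strip of `Y` exactly when moreover `βs +
Φ_H(s) < b` (`mem_fundamentalStrip_mixedTS`). The function `g(s) = βs + Φ_H(s)` is strictly convex
with `g(0) = 0 < b`. On each side of `0` it therefore stays below `b` if its end value does, and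
crosses `b` exactly once if its end value exceeds `b`; the four cases combine these two
alternatives.

The substance is the conditional exponential moment, since the law is given only through its
characteristic function. The law is a weak limit of compensated compound Poisson laws, whose
exponential moments are explicit; a finite Lévy integral at a slightly larger exponent supplies the
uniform integrability that carries the moments to the limit (`lintegral_exp_of_charFun_eq`). The
Lévy integral is evaluated by Taylor's formula, Tonelli and the Gamma integral. This settles the
open interval. The end points follow by Fatou and dominated convergence
(`lintegral_exp_eq_of_mem_Icc`). Beyond them, a finite moment would make the cumulant generating
function analytic at the end point, whereas `Φ_H''` blows up there (`lintegral_exp_eq_top_of_lt`).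
-/

namespace MixedTS

open Filter Topology
open scoped ENNReal NNReal

/-! ### Compound Poisson laws and their transforms. -/

/-- The `n`-th convolution power of a measure on `ℝ`. -/
noncomputable def convPow (η : Measure ℝ) : ℕ → Measure ℝ
  | 0 => Measure.dirac 0
  | n + 1 => convPow η n ∗ η

instance isFiniteMeasure_convPow (η : Measure ℝ) [IsFiniteMeasure η] (n : ℕ) :
    IsFiniteMeasure (convPow η n) := by
  induction n with
  | zero => unfold convPow; infer_instance
  | succ n ih => unfold convPow; infer_instance

theorem charFun_convPow (η : Measure ℝ) [IsFiniteMeasure η] (n : ℕ) (t : ℝ) :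
    charFun (convPow η n) t = charFun η t ^ n := by
  induction n with
  | zero => simp [convPow, charFun_dirac]
  | succ n ih => rw [convPow, charFun_conv, ih, pow_succ]

theorem measurable_ofReal_exp_mul (s : ℝ) :
    Measurable fun x : ℝ => ENNReal.ofReal (Real.exp (s * x)) := by fun_prop

theorem lintegral_exp_convPow (η : Measure ℝ) [IsFiniteMeasure η] (n : ℕ) (s : ℝ) :
    ∫⁻ x, ENNReal.ofReal (Real.exp (s * x)) ∂(convPow η n) =
      (∫⁻ x, ENNReal.ofReal (Real.exp (s * x)) ∂η) ^ n := by
  induction n with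
  | zero => simp [convPow, lintegral_dirac' _ (measurable_ofReal_exp_mul s)]
  | succ n ih =>
    rw [convPow, Measure.lintegral_conv (measurable_ofReal_exp_mul s), pow_succ, ← ih,
      ← lintegral_mul_const _ (measurable_ofReal_exp_mul s)]
    refine lintegral_congr fun x => ?_
    rw [← lintegral_const_mul _ (measurable_ofReal_exp_mul s)]
    refine lintegral_congr fun y => ?_
    rw [mul_add, Real.exp_add, ENNReal.ofReal_mul (Real.exp_nonneg _)]

/-- The compound Poisson law with finite jump measure `η`. -/
noncomputable def compoundPoisson (η : Measure ℝ) : Measure ℝ :=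
  Measure.sum fun n : ℕ =>
    ENNReal.ofReal (Real.exp (-η.real Set.univ) / n.factorial) • convPow η n

/-- Moments of convolution powers are powers, so the Poisson mixture sums to an exponential series.
Taking `s = 0` also yields total mass one. -/
theorem lintegral_exp_compoundPoisson (η : Measure ℝ) [IsFiniteMeasure η] {s a : ℝ} (ha : 0 ≤ a)
    (hη : ∫⁻ x, ENNReal.ofReal (Real.exp (s * x)) ∂η = ENNReal.ofReal a) :
    ∫⁻ x, ENNReal.ofReal (Real.exp (s * x)) ∂(compoundPoisson η) =
      ENNReal.ofReal (Real.exp (a - η.real Set.univ)) := by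
  have h : HasSum (fun n : ℕ => Real.exp (-η.real Set.univ) * (a ^ n / n.factorial))
      (Real.exp (-η.real Set.univ) * Real.exp a) := by
    refine HasSum.mul_left _ ?_
    rw [Real.exp_eq_exp_ℝ]
    exact NormedSpace.expSeries_div_hasSum_exp a
  rw [compoundPoisson, lintegral_sum_measure]
  simp_rw [lintegral_smul_measure, lintegral_exp_convPow, hη]
  rw [sub_eq_neg_add, Real.exp_add, ← h.tsum_eq, ENNReal.ofReal_tsum_of_nonneg _ h.summable]
  · refine tsum_congr fun n => ?_
    rw [smul_eq_mul, ← ENNReal.ofReal_pow ha, ← ENNReal.ofReal_mul (by positivity)]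
    congr 1
    ring
  · intro n; positivity

instance isProbabilityMeasure_compoundPoisson (η : Measure ℝ) [IsFiniteMeasure η] :
    IsProbabilityMeasure (compoundPoisson η) := by
  refine ⟨?_⟩
  have h := lintegral_exp_compoundPoisson η (s := 0) (a := η.real Set.univ) measureReal_nonneg
    (by simp)
  simpa using h

theorem charFun_compoundPoisson (η : Measure ℝ) [IsFiniteMeasure η] (t : ℝ) :
    charFun (compoundPoisson η) t = Complex.exp (charFun η t - η.real Set.univ) := by
  have hint : Integrable (fun x : ℝ => Complex.exp (t * x * Complex.I)) (compoundPoisson η) := by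
    refine Integrable.of_bound (C := 1) (by fun_prop) (ae_of_all _ fun x => ?_)
    rw [← Complex.ofReal_mul, Complex.norm_exp_ofReal_mul_I]
  have h1 := hasSum_integral_measure (f := fun x : ℝ => Complex.exp (t * x * Complex.I)) hint
  simp_rw [integral_smul_measure, ← charFun_apply_real, charFun_convPow] at h1
  have h2 : HasSum (fun n : ℕ => Complex.exp (-η.real Set.univ) * (charFun η t ^ n / n.factorial))
      (Complex.exp (-η.real Set.univ) * Complex.exp (charFun η t)) := by
    refine HasSum.mul_left _ ?_
    rw [Complex.exp_eq_exp_ℂ]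
    exact NormedSpace.expSeries_div_hasSum_exp _
  rw [sub_eq_neg_add, Complex.exp_add, ← h2.tsum_eq]
  unfold compoundPoisson
  rw [← h1.tsum_eq]
  refine tsum_congr fun n => ?_
  rw [ENNReal.toReal_ofReal (by positivity), Complex.real_smul]
  push_cast
  ring

/-! ### Approximation of infinitely divisible laws by truncating small jumps. -/

/-- Second-order Taylor bound for `|y| ≤ 1`, triangle inequality beyond. The quadratic bound on all
of `ℝ` makes a finite second moment of `ν` the only condition needed for the Lévy–Khintchine
integral. -/
theorem norm_cexp_sub_one_sub_le (y : ℝ) :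
    ‖Complex.exp (Complex.I * y) - 1 - Complex.I * y‖ ≤ 3 * y ^ 2 := by
  have hn : ‖Complex.I * (y : ℂ)‖ = |y| := by simp
  rcases le_or_gt |y| 1 with h | h
  · have := Complex.norm_exp_sub_one_sub_id_le (x := Complex.I * y) (by rw [hn]; exact h)
    rw [hn, sq_abs] at this
    nlinarith [sq_nonneg y]
  · have h1 : ‖Complex.exp (Complex.I * y)‖ = 1 := by
      rw [mul_comm]; exact Complex.norm_exp_ofReal_mul_I y
    calc _ ≤ ‖Complex.exp (Complex.I * y)‖ + ‖(1 : ℂ)‖ + ‖Complex.I * (y : ℂ)‖ :=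
          (norm_sub_le _ _).trans (by gcongr; exact norm_sub_le _ _)
      _ = 2 + |y| := by rw [h1, hn, norm_one]; ring
      _ ≤ 3 * y ^ 2 := by rw [← sq_abs]; nlinarith

theorem integrable_cexp_sub_one_sub {ν : Measure ℝ} (h2 : Integrable (fun x : ℝ => x ^ 2) ν)
    (t : ℝ) :
    Integrable (fun x : ℝ => Complex.exp (Complex.I * t * x) - 1 - Complex.I * t * x) ν := by
  refine (h2.const_mul (3 * t ^ 2)).mono' (by fun_prop) (ae_of_all _ fun x => ?_)
  have := norm_cexp_sub_one_sub_le (t * x)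
  push_cast at this
  rw [← mul_assoc] at this
  refine this.trans (le_of_eq (by ring))

/-- The set of jumps of size larger than `1 / (n + 1)`. -/
def bigJumps (n : ℕ) : Set ℝ := {x | 1 / ((n : ℝ) + 1) < |x|}

theorem measurableSet_bigJumps (n : ℕ) : MeasurableSet (bigJumps n) :=
  measurableSet_lt measurable_const (by fun_prop)

/-- Dominated convergence: every nonzero `x` is eventually a big jump. The point `0` never is, hence
the condition `f 0 = 0`. -/
theorem tendsto_setIntegral_bigJumps {E : Type*} [NormedAddCommGroup E] [NormedSpace ℝ E]
    {ν : Measure ℝ} {f : ℝ → E} (hf : Integrable f ν) (h0 : f 0 = 0) :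
    Tendsto (fun n : ℕ => ∫ x in bigJumps n, f x ∂ν) atTop (𝓝 (∫ x, f x ∂ν)) := by
  simp_rw [← integral_indicator (measurableSet_bigJumps _)]
  refine tendsto_integral_of_dominated_convergence (fun x => ‖f x‖)
    (fun n => hf.1.indicator (measurableSet_bigJumps n)) hf.norm
    (fun n => ae_of_all _ fun x => norm_indicator_le_norm_self _ _) (ae_of_all _ fun x => ?_)
  rcases eq_or_ne x 0 with rfl | hx
  · simp [Set.indicator, h0]
  · refine tendsto_const_nhds.congr' ?_
    have := tendsto_one_div_add_atTop_nhds_zero_nat (𝕜 := ℝ)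
    filter_upwards [this.eventually_lt_const (abs_pos.2 hx)] with n hn
    rw [Set.indicator_of_mem]
    exact hn

theorem isFiniteMeasure_restrict_bigJumps {ν : Measure ℝ}
    (h2 : Integrable (fun x : ℝ => x ^ 2) ν) (n : ℕ) :
    IsFiniteMeasure (ν.restrict (bigJumps n)) := by
  refine isFiniteMeasure_restrict.2 (ne_of_lt ?_)
  have h := h2.measure_norm_ge_lt_top (ε := (1 / ((n : ℝ) + 1)) ^ 2) (by positivity)
  refine (measure_mono fun x hx => ?_).trans_lt h
  simp only [bigJumps, Set.mem_ofPred_eq] at hx ⊢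
  rw [Real.norm_eq_abs, abs_pow]
  exact pow_le_pow_left₀ (by positivity) hx.le 2

theorem integrableOn_id_bigJumps {ν : Measure ℝ}
    (h2 : Integrable (fun x : ℝ => x ^ 2) ν) (n : ℕ) :
    IntegrableOn (fun x : ℝ => x) (bigJumps n) ν := by
  refine Integrable.mono' (h2.integrableOn.const_mul ((n : ℝ) + 1)) (by fun_prop)
    ((ae_restrict_iff' (measurableSet_bigJumps n)).2 (ae_of_all _ fun x hx => ?_))
  have hn : (0 : ℝ) < (n : ℝ) + 1 := by positivity
  have h1 : 1 < |x| * ((n : ℝ) + 1) := (div_lt_iff₀ hn).1 hx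
  rw [Real.norm_eq_abs, ← sq_abs]
  nlinarith [abs_nonneg x]

/-- The centred compound Poisson law whose jumps are those of `ν` larger than `1 / (n + 1)`. -/
noncomputable def truncatedLaw (ν : Measure ℝ) (n : ℕ) : Measure ℝ :=
  (compoundPoisson (ν.restrict (bigJumps n))).map (· + -∫ x in bigJumps n, x ∂ν)

theorem isProbabilityMeasure_truncatedLaw {ν : Measure ℝ}
    (h2 : Integrable (fun x : ℝ => x ^ 2) ν) (n : ℕ) :
    IsProbabilityMeasure (truncatedLaw ν n) := by
  have := isFiniteMeasure_restrict_bigJumps h2 n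
  exact Measure.isProbabilityMeasure_map (by fun_prop)

/-- The shift by the mean jump supplies the compensator `-itx`, which is separately integrable once
small jumps are removed. -/
theorem charFun_truncatedLaw {ν : Measure ℝ} (h2 : Integrable (fun x : ℝ => x ^ 2) ν) (n : ℕ)
    (t : ℝ) :
    charFun (truncatedLaw ν n) t = Complex.exp (∫ x in bigJumps n,
      (Complex.exp (Complex.I * t * x) - 1 - Complex.I * t * x) ∂ν) := by
  have := isFiniteMeasure_restrict_bigJumps h2 n
  have hi : IntegrableOn (fun x : ℝ => (x : ℂ)) (bigJumps n) ν :=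
    (integrableOn_id_bigJumps h2 n).ofReal (𝕜 := ℂ)
  have he : IntegrableOn (fun x : ℝ => Complex.exp (Complex.I * t * x)) (bigJumps n) ν := by
    refine Integrable.of_bound (C := 1) (by fun_prop) (ae_of_all _ fun x => ?_)
    rw [mul_assoc, ← Complex.ofReal_mul, mul_comm, Complex.norm_exp_ofReal_mul_I]
  have hc : IntegrableOn (fun _ : ℝ => (1 : ℂ)) (bigJumps n) ν := integrable_const _
  have hec : IntegrableOn (fun x : ℝ => Complex.exp (Complex.I * t * x) - 1) (bigJumps n) ν :=
    he.sub hc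
  rw [truncatedLaw, charFun_map_add_const, charFun_compoundPoisson, ← Complex.exp_add,
    integral_sub hec (hi.const_mul _), integral_sub he hc, integral_const_mul, charFun_apply_real]
  congr 1
  have h1 : ∀ x : ℝ, (t : ℂ) * x * Complex.I = Complex.I * t * x := fun x => by ring
  have h3 : (∫ x in bigJumps n, ((x : ℝ) : ℂ) ∂ν) = ((∫ x in bigJumps n, x ∂ν : ℝ) : ℂ) :=
    integral_ofReal
  simp only [h1, integral_const, RCLike.inner_apply, conj_trivial,
    Complex.real_smul, mul_one]
  rw [h3]
  push_cast
  ring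

theorem lintegral_exp_truncatedLaw {ν : Measure ℝ} (h2 : Integrable (fun x : ℝ => x ^ 2) ν)
    {s : ℝ} (hs : Integrable (fun x : ℝ => Real.exp (s * x) - 1 - s * x) ν) (n : ℕ) :
    ∫⁻ x, ENNReal.ofReal (Real.exp (s * x)) ∂(truncatedLaw ν n) =
      ENNReal.ofReal (Real.exp (∫ x in bigJumps n, (Real.exp (s * x) - 1 - s * x) ∂ν)) := by
  have := isFiniteMeasure_restrict_bigJumps h2 n
  have hi := integrableOn_id_bigJumps h2 n
  have hc : IntegrableOn (fun _ : ℝ => (1 : ℝ)) (bigJumps n) ν := integrable_const _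
  have he : IntegrableOn (fun x : ℝ => Real.exp (s * x)) (bigJumps n) ν := by
    refine ((hs.integrableOn.add hc).add (hi.const_mul s)).congr (ae_of_all _ fun x => ?_)
    simp only [Pi.add_apply]
    ring
  have hec : IntegrableOn (fun x : ℝ => Real.exp (s * x) - 1) (bigJumps n) ν := he.sub hc
  have hl : ∫⁻ x, ENNReal.ofReal (Real.exp (s * x)) ∂(ν.restrict (bigJumps n)) =
      ENNReal.ofReal (∫ x in bigJumps n, Real.exp (s * x) ∂ν) :=
    (ofReal_integral_eq_lintegral_ofReal he (ae_of_all _ fun x => Real.exp_nonneg _)).symm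
  rw [truncatedLaw, lintegral_map (measurable_ofReal_exp_mul s) (by fun_prop)]
  simp_rw [mul_add, Real.exp_add, ENNReal.ofReal_mul (Real.exp_nonneg _)]
  rw [lintegral_mul_const _ (measurable_ofReal_exp_mul s),
    lintegral_exp_compoundPoisson _ (integral_nonneg fun x => Real.exp_nonneg _) hl,
    ← ENNReal.ofReal_mul (Real.exp_nonneg _), ← Real.exp_add,
    integral_sub hec (hi.const_mul _), integral_sub he hc, integral_const_mul]
  congr 2
  simp only [integral_const, smul_eq_mul, mul_one]
  ring

theorem tendsto_lintegral_exp_truncatedLaw {ν : Measure ℝ}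
    (h2 : Integrable (fun x : ℝ => x ^ 2) ν) {s : ℝ}
    (hs : Integrable (fun x : ℝ => Real.exp (s * x) - 1 - s * x) ν) :
    Tendsto (fun n => ∫⁻ x, ENNReal.ofReal (Real.exp (s * x)) ∂(truncatedLaw ν n)) atTop
      (𝓝 (ENNReal.ofReal (Real.exp (∫ x, (Real.exp (s * x) - 1 - s * x) ∂ν)))) := by
  simp_rw [lintegral_exp_truncatedLaw h2 hs]
  exact (ENNReal.continuous_ofReal.tendsto _).comp
    ((Real.continuous_exp.tendsto _).comp (tendsto_setIntegral_bigJumps hs (by simp)))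

/-- Lévy's continuity theorem: the exponents converge pointwise, so the truncated laws converge
weakly to `ρ`. -/
theorem tendsto_lintegral_truncatedLaw {ν ρ : Measure ℝ} [IsProbabilityMeasure ρ]
    (h2 : Integrable (fun x : ℝ => x ^ 2) ν)
    (hρ : ∀ t : ℝ, charFun ρ t =
      Complex.exp (∫ x, (Complex.exp (Complex.I * t * x) - 1 - Complex.I * t * x) ∂ν))
    (f : BoundedContinuousFunction ℝ ℝ≥0) :
    Tendsto (fun n => ∫⁻ x, f x ∂(truncatedLaw ν n)) atTop (𝓝 (∫⁻ x, f x ∂ρ)) := by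
  let μs : ℕ → ProbabilityMeasure ℝ :=
    fun n => ⟨truncatedLaw ν n, isProbabilityMeasure_truncatedLaw h2 n⟩
  have h : Tendsto μs atTop (𝓝 ⟨ρ, inferInstance⟩) := by
    refine ProbabilityMeasure.tendsto_iff_tendsto_charFun.2 fun t => ?_
    simp only [μs, ProbabilityMeasure.coe_mk, charFun_truncatedLaw h2, hρ]
    exact (Complex.continuous_exp.tendsto _).comp
      (tendsto_setIntegral_bigJumps (integrable_cexp_sub_one_sub h2 t) (by simp))
  exact ProbabilityMeasure.tendsto_iff_forall_lintegral_tendsto.1 h f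

/-! ### Passing exponential moments to the weak limit. -/

/-- The exponential `x ↦ e^{sx}` truncated at the level `e^k`. -/
noncomputable def truncExp (s k : ℝ) : BoundedContinuousFunction ℝ ℝ≥0 :=
  BoundedContinuousFunction.mkOfBound
    ⟨fun x : ℝ => Real.toNNReal (Real.exp (min (s * x) k)), by fun_prop⟩
    (Real.exp k) (fun x y => by
      simp only [ContinuousMap.coe_mk, NNReal.dist_eq, Real.coe_toNNReal _ (Real.exp_nonneg _)]
      have hx := Real.exp_le_exp.2 (min_le_right (s * x) k)
      have hy := Real.exp_le_exp.2 (min_le_right (s * y) k)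
      rw [abs_le]
      constructor <;> linarith [Real.exp_pos (min (s * x) k), Real.exp_pos (min (s * y) k)])

theorem coe_truncExp (s k x : ℝ) :
    ((truncExp s k x : ℝ≥0) : ℝ≥0∞) = ENNReal.ofReal (Real.exp (min (s * x) k)) := rfl

theorem truncExp_le (s k x : ℝ) :
    ((truncExp s k x : ℝ≥0) : ℝ≥0∞) ≤ ENNReal.ofReal (Real.exp (s * x)) := by
  rw [coe_truncExp]
  exact ENNReal.ofReal_le_ofReal (Real.exp_le_exp.2 (min_le_left _ _))

/-- Where `sx ≥ k`, one has `e^{sx} = e^{psx} e^{-(p-1)sx} ≤ e^{-(p-1)k} e^{psx}`. A bounded moment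
at `ps` thus gives uniform integrability at `s`. -/
theorem le_truncExp_add {p : ℝ} (hp : 1 < p) (s k x : ℝ) :
    ENNReal.ofReal (Real.exp (s * x)) ≤ (truncExp s k x : ℝ≥0) +
      ENNReal.ofReal (Real.exp (-(p - 1) * k)) * ENNReal.ofReal (Real.exp (p * s * x)) := by
  rcases le_total (s * x) k with h | h
  · rw [coe_truncExp, min_eq_left h]
    exact le_self_add
  · refine le_add_left ?_
    rw [← ENNReal.ofReal_mul (Real.exp_nonneg _), ← Real.exp_add]
    refine ENNReal.ofReal_le_ofReal (Real.exp_le_exp.2 ?_)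
    nlinarith

/-- The exponential moment at `s` of a law with Lévy–Khintchine exponent
`t ↦ ∫ (e^{itx} - 1 - itx) ν(dx)`, at a point `s` that is not extremal for `ν`. -/
theorem lintegral_exp_of_charFun_eq {ν ρ : Measure ℝ} [IsProbabilityMeasure ρ]
    (h2 : Integrable (fun x : ℝ => x ^ 2) ν)
    (hρ : ∀ t : ℝ, charFun ρ t =
      Complex.exp (∫ x, (Complex.exp (Complex.I * t * x) - 1 - Complex.I * t * x) ∂ν))
    {s p : ℝ} (hp : 1 < p) (hs : Integrable (fun x : ℝ => Real.exp (s * x) - 1 - s * x) ν)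
    (hps : Integrable (fun x : ℝ => Real.exp (p * s * x) - 1 - p * s * x) ν) :
    ∫⁻ x, ENNReal.ofReal (Real.exp (s * x)) ∂ρ =
      ENNReal.ofReal (Real.exp (∫ x, (Real.exp (s * x) - 1 - s * x) ∂ν)) := by
  have hw := tendsto_lintegral_truncatedLaw h2 hρ
  have hm := tendsto_lintegral_exp_truncatedLaw h2 hs
  refine le_antisymm ?_ ?_
  -- Upper bound: truncate, pass to the weak limit in `n`, then let `k → ∞` by monotone convergence.
  · have hk : ∀ k : ℕ, ∫⁻ x, (truncExp s k x : ℝ≥0) ∂ρ ≤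
        ENNReal.ofReal (Real.exp (∫ x, (Real.exp (s * x) - 1 - s * x) ∂ν)) := fun k =>
      le_of_tendsto_of_tendsto' (hw _) hm fun n => lintegral_mono fun x => truncExp_le s k x
    have hlim : Tendsto (fun k : ℕ => ∫⁻ x, (truncExp s k x : ℝ≥0) ∂ρ) atTop
        (𝓝 (∫⁻ x, ENNReal.ofReal (Real.exp (s * x)) ∂ρ)) := by
      refine lintegral_tendsto_of_tendsto_of_monotone
        (fun k => ((truncExp s k).continuous.measurable.coe_nnreal_ennreal).aemeasurable)
        (ae_of_all _ fun x i j hij => ?_) (ae_of_all _ fun x => ?_)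
      · simp only [coe_truncExp]
        refine ENNReal.ofReal_le_ofReal (Real.exp_le_exp.2 (min_le_min_left _ ?_))
        exact_mod_cast hij
      · refine tendsto_const_nhds.congr' ?_
        filter_upwards [eventually_ge_atTop ⌈s * x⌉₊] with k hk
        rw [coe_truncExp, min_eq_left (Nat.ceil_le.1 hk)]
    exact le_of_tendsto' hlim hk
  -- Lower bound: the mass lost by truncation is at most `e^{-(p-1)k} C` in the limit, which
  -- vanishes as `k → ∞`.
  · have hpm := tendsto_lintegral_exp_truncatedLaw h2 hps
    set C := ENNReal.ofReal (Real.exp (∫ x, (Real.exp (p * s * x) - 1 - p * s * x) ∂ν))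
    have hk : ∀ k : ℕ, ENNReal.ofReal (Real.exp (∫ x, (Real.exp (s * x) - 1 - s * x) ∂ν)) ≤
        ∫⁻ x, ENNReal.ofReal (Real.exp (s * x)) ∂ρ +
          ENNReal.ofReal (Real.exp (-(p - 1) * k)) * C := by
      intro k
      have hlim := (hw (truncExp s k)).add
        (ENNReal.Tendsto.const_mul (a := ENNReal.ofReal (Real.exp (-(p - 1) * k))) hpm
          (Or.inr ENNReal.ofReal_ne_top))
      refine (le_of_tendsto_of_tendsto' hm hlim fun n => ?_).trans
        (add_le_add_left (lintegral_mono fun x => truncExp_le s k x) _)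
      rw [← lintegral_const_mul _ (measurable_ofReal_exp_mul _),
        ← lintegral_add_right _ ((measurable_ofReal_exp_mul _).const_mul _)]
      exact lintegral_mono fun x => le_truncExp_add hp s k x
    have h0 : Tendsto (fun k : ℕ => ENNReal.ofReal (Real.exp (-(p - 1) * k)) * C) atTop (𝓝 0) := by
      have h1 : Tendsto (fun k : ℕ => Real.exp (-(p - 1) * k)) atTop (𝓝 0) := by
        refine Real.tendsto_exp_atBot.comp ?_
        exact tendsto_natCast_atTop_atTop.const_mul_atTop_of_neg (by linarith)
      have h2 := ENNReal.Tendsto.mul_const (b := C)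
        ((ENNReal.continuous_ofReal.tendsto _).comp h1) (Or.inr ENNReal.ofReal_ne_top)
      simpa using h2
    have := ge_of_tendsto' (tendsto_const_nhds.add h0) hk
    simpa using this

/-! ### Taylor's formula and the one-sided tempered stable integrals. -/

/-- Second order Taylor expansion at `0` with integral remainder, for a convex function. -/
theorem taylor_two_of_convex {f f' f'' : ℝ → ℝ} {s : ℝ}
    (hf : ∀ r ∈ Set.Icc (0 : ℝ) 1, HasDerivAt f (f' (r * s)) (r * s))
    (hf' : ∀ r ∈ Set.Icc (0 : ℝ) 1, HasDerivAt f' (f'' (r * s)) (r * s))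
    (hc : ContinuousOn (fun r => f'' (r * s)) (Set.Icc 0 1))
    (hpos : ∀ r ∈ Set.Icc (0 : ℝ) 1, 0 ≤ f'' (r * s)) :
    0 ≤ f s - f 0 - s * f' 0 ∧
    ∫⁻ r in Set.Ioc (0 : ℝ) 1, ENNReal.ofReal ((1 - r) * s ^ 2 * f'' (r * s)) =
      ENNReal.ofReal (f s - f 0 - s * f' 0) := by
  -- In the derivative of `f(rs) + (1-r)s f'(rs)` the first-order terms cancel, leaving the
  -- remainder integrand.
  have hder : ∀ r ∈ Set.uIcc (0 : ℝ) 1, HasDerivAt (fun r => f (r * s) + (1 - r) * s * f' (r * s))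
      ((1 - r) * s ^ 2 * f'' (r * s)) r := by
    intro r hr
    rw [Set.uIcc_of_le zero_le_one] at hr
    have hl : HasDerivAt (fun r : ℝ => r * s) s r := by simpa using (hasDerivAt_id r).mul_const s
    have h1 := (hf r hr).comp r hl
    have h2 := (hf' r hr).comp r hl
    have h3 : HasDerivAt (fun r : ℝ => (1 - r) * s) (-s) r := by
      simpa using ((hasDerivAt_id r).const_sub 1).mul_const s
    refine (h1.add (h3.mul h2)).congr_deriv ?_
    simp only [Function.comp]
    ring
  have hcont : ContinuousOn (fun r => (1 - r) * s ^ 2 * f'' (r * s)) (Set.Icc 0 1) :=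
    ContinuousOn.mul (by fun_prop) hc
  have hint : IntervalIntegrable (fun r => (1 - r) * s ^ 2 * f'' (r * s)) volume 0 1 :=
    hcont.intervalIntegrable_of_Icc zero_le_one
  have h := intervalIntegral.integral_eq_sub_of_hasDerivAt hder hint
  rw [intervalIntegral.integral_of_le zero_le_one] at h
  have hnn : ∀ᵐ r ∂(volume.restrict (Set.Ioc (0 : ℝ) 1)), 0 ≤ (1 - r) * s ^ 2 * f'' (r * s) := by
    refine (ae_restrict_iff' measurableSet_Ioc).2 (ae_of_all _ fun r hr => ?_)
    exact mul_nonneg (mul_nonneg (by linarith [hr.2]) (sq_nonneg s)) (hpos r ⟨hr.1.le, hr.2⟩)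
  have hval : ∫ r in Set.Ioc (0 : ℝ) 1, (1 - r) * s ^ 2 * f'' (r * s) =
      f s - f 0 - s * f' 0 := by
    rw [h]
    simp only [one_mul, sub_self, zero_mul, sub_zero]
    ring
  rw [← hval]
  exact ⟨integral_nonneg_of_ae hnn, (ofReal_integral_eq_lintegral_ofReal
    ((intervalIntegrable_iff_integrableOn_Ioc_of_le zero_le_one).1 hint) hnn).symm⟩

theorem lintegral_taylor_exp (y : ℝ) :
    ∫⁻ r in Set.Ioc (0 : ℝ) 1, ENNReal.ofReal ((1 - r) * y ^ 2 * Real.exp (r * y)) =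
      ENNReal.ofReal (Real.exp y - 1 - y) := by
  have := taylor_two_of_convex (f := Real.exp) (f' := Real.exp) (f'' := Real.exp) (s := y)
    (fun r _ => Real.hasDerivAt_exp _) (fun r _ => Real.hasDerivAt_exp _) (by fun_prop)
    (fun r _ => Real.exp_nonneg _)
  simpa using this.2

/-- The contribution of the jumps of one sign to the cumulant generating function, up to the factor
`Γ(2 - α)`: `s ↦ Γ(2 - α)⁻¹ ∫ (e^{sx} - 1 - sx) e^{-lam x} x^{-1-α} dx` over `x > 0`. -/
noncomputable def halfCgf (α lam s : ℝ) : ℝ :=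
  if α = 1 then (lam - s) * Real.log ((lam - s) / lam) + s
  else ((lam - s) ^ α - lam ^ α) / (α * (α - 1)) + lam ^ (α - 1) * s / (α - 1)

/-- The derivative of `halfCgf`. -/
noncomputable def halfCgfDeriv (α lam s : ℝ) : ℝ :=
  if α = 1 then -Real.log ((lam - s) / lam)
  else (lam ^ (α - 1) - (lam - s) ^ (α - 1)) / (α - 1)

theorem halfCgf_zero (α : ℝ) {lam : ℝ} (hlam : 0 < lam) : halfCgf α lam 0 = 0 := by
  simp [halfCgf, hlam.ne']

theorem halfCgfDeriv_zero (α : ℝ) {lam : ℝ} (hlam : 0 < lam) : halfCgfDeriv α lam 0 = 0 := by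
  simp [halfCgfDeriv, hlam.ne']

theorem hasDerivAt_halfCgf {α lam s : ℝ} (hα : 0 < α) (hlam : 0 < lam) (hs : s < lam) :
    HasDerivAt (halfCgf α lam) (halfCgfDeriv α lam s) s := by
  have hl : HasDerivAt (fun s : ℝ => lam - s) (-1) s := (hasDerivAt_id s).const_sub lam
  have hpos : 0 < lam - s := sub_pos.2 hs
  by_cases h1 : α = 1
  · have hlog := (hl.div_const lam).log (by positivity)
    have heq : halfCgf α lam = fun s => (lam - s) * Real.log ((lam - s) / lam) + s := by
      funext s; simp [halfCgf, h1]
    rw [heq]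
    refine ((hl.mul hlog).add (hasDerivAt_id s)).congr_deriv ?_
    simp only [halfCgfDeriv, h1, if_true]
    field_simp
    ring
  · have h1' : α - 1 ≠ 0 := sub_ne_zero.2 h1
    have heq : halfCgf α lam = fun s => ((lam - s) ^ α - lam ^ α) / (α * (α - 1)) +
        lam ^ (α - 1) * s / (α - 1) := by
      funext s; simp [halfCgf, h1]
    rw [heq]
    refine ((((hl.rpow_const (p := α) (Or.inl hpos.ne')).sub_const _).div_const _).add
      (((hasDerivAt_id s).const_mul _).div_const _)).congr_deriv ?_
    simp only [halfCgfDeriv, h1, if_false]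
    field_simp
    ring

/-- The second derivative has one formula for all `α`, so the exceptional role of `α = 1` ends here.
-/
theorem hasDerivAt_halfCgfDeriv {α lam s : ℝ} (hlam : 0 < lam) (hs : s < lam) :
    HasDerivAt (halfCgfDeriv α lam) ((lam - s) ^ (α - 2)) s := by
  have hl : HasDerivAt (fun s : ℝ => lam - s) (-1) s := (hasDerivAt_id s).const_sub lam
  have hpos : 0 < lam - s := sub_pos.2 hs
  by_cases h1 : α = 1
  · have hlog := (hl.div_const lam).log (by positivity)
    have heq : halfCgfDeriv α lam = fun s => -Real.log ((lam - s) / lam) := by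
      funext s; simp [halfCgfDeriv, h1]
    rw [heq]
    refine hlog.neg.congr_deriv ?_
    rw [h1, show (1 : ℝ) - 2 = -1 by norm_num, Real.rpow_neg_one]
    field_simp
  · have h1' : α - 1 ≠ 0 := sub_ne_zero.2 h1
    have heq : halfCgfDeriv α lam = fun s => (lam ^ (α - 1) - (lam - s) ^ (α - 1)) / (α - 1) := by
      funext s; simp [halfCgfDeriv, h1]
    rw [heq]
    refine (((hl.rpow_const (p := α - 1) (Or.inl hpos.ne')).const_sub _).div_const _).congr_deriv ?_
    rw [show α - 1 - 1 = α - 2 by ring]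
    field_simp

/-- Needed at the end point `s = lam`, where differentiability may fail: `x log x` and, for `α > 0`,
`x ^ α` are continuous at `0`. -/
theorem continuous_halfCgf {α lam : ℝ} (hα : 0 < α) (hlam : 0 < lam) :
    Continuous (halfCgf α lam) := by
  by_cases h1 : α = 1
  · have heq : halfCgf α lam =
        fun s => lam * ((lam - s) / lam * Real.log ((lam - s) / lam)) + s := by
      funext s
      simp only [halfCgf, h1, if_true]
      field_simp
    rw [heq]
    have := Real.continuous_mul_log.comp (g := fun x : ℝ => x * Real.log x)
      (f := fun s : ℝ => (lam - s) / lam) (by fun_prop)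
    simp only [Function.comp_def] at this
    fun_prop
  · have heq : halfCgf α lam = fun s => ((lam - s) ^ α - lam ^ α) / (α * (α - 1)) +
        lam ^ (α - 1) * s / (α - 1) := by
      funext s; simp [halfCgf, h1]
    rw [heq]
    have : Continuous fun s : ℝ => (lam - s) ^ α :=
      (continuous_const.sub continuous_id).rpow_const fun _ => Or.inr hα.le
    fun_prop

/-- The factor `x ^ 2` tames the singularity at `0` and leaves a Gamma integral of positive index `2
- α`. -/
theorem lintegral_sq_mul_exp_tempered {α lam s : ℝ} (hα : α < 2) (hs : s < lam) :
    ∫⁻ x in Set.Ioi (0 : ℝ),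
      ENNReal.ofReal (x ^ 2 * Real.exp (s * x) * (Real.exp (-lam * x) * x ^ (-1 - α))) =
      ENNReal.ofReal (Real.Gamma (2 - α) * (lam - s) ^ (α - 2)) := by
  have hpos : 0 < lam - s := sub_pos.2 hs
  have ha : 0 < 2 - α := by linarith
  have heq : ∀ x ∈ Set.Ioi (0 : ℝ), x ^ 2 * Real.exp (s * x) * (Real.exp (-lam * x) * x ^ (-1 - α))
      = x ^ (2 - α - 1) * Real.exp (-((lam - s) * x)) := by
    intro x hx
    rw [show 2 - α - 1 = 2 + (-1 - α) by ring, Real.rpow_add hx, Real.rpow_two,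
      show -((lam - s) * x) = s * x + -lam * x by ring, Real.exp_add]
    ring
  rw [setLIntegral_congr_fun measurableSet_Ioi fun x hx => congrArg ENNReal.ofReal (heq x hx)]
  have hval := Real.integral_rpow_mul_exp_neg_mul_Ioi ha hpos
  have hint : IntegrableOn (fun x : ℝ => x ^ (2 - α - 1) * Real.exp (-((lam - s) * x)))
      (Set.Ioi 0) := by
    -- A non-integrable function has Bochner integral `0`, but the Gamma formula gives a positive
    -- value.
    by_contra hcon
    rw [integral_undef hcon] at hval
    have := Real.Gamma_pos_of_pos ha
    have : 0 < (1 / (lam - s)) ^ (2 - α) * Real.Gamma (2 - α) := by positivity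
    linarith
  rw [← ofReal_integral_eq_lintegral_ofReal hint, hval]
  · rw [one_div, Real.inv_rpow hpos.le, ← Real.rpow_neg hpos.le, neg_sub, mul_comm]
  · refine (ae_restrict_iff' measurableSet_Ioi).2 (ae_of_all _ fun x hx => ?_)
    have hx' : (0 : ℝ) < x := hx
    simp only [Pi.zero_apply]
    positivity

theorem taylor_halfCgf {α lam s : ℝ} (hα : 0 < α) (hlam : 0 < lam) (hs : s < lam) :
    0 ≤ halfCgf α lam s ∧
    ∫⁻ r in Set.Ioc (0 : ℝ) 1, ENNReal.ofReal ((1 - r) * s ^ 2 * (lam - r * s) ^ (α - 2)) =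
      ENNReal.ofReal (halfCgf α lam s) := by
  have hseg : ∀ r ∈ Set.Icc (0 : ℝ) 1, r * s < lam := fun r hr => by
    rcases le_total 0 s with h | h <;> nlinarith [hr.1, hr.2]
  have htay := taylor_two_of_convex (f := halfCgf α lam) (f' := halfCgfDeriv α lam)
    (f'' := fun s => (lam - s) ^ (α - 2)) (s := s)
    (fun r hr => hasDerivAt_halfCgf hα hlam (hseg r hr))
    (fun r hr => hasDerivAt_halfCgfDeriv hlam (hseg r hr))
    (ContinuousOn.rpow_const (by fun_prop) fun r hr => Or.inl (sub_pos.2 (hseg r hr)).ne')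
    (fun r hr => Real.rpow_nonneg (sub_pos.2 (hseg r hr)).le _)
  rwa [halfCgf_zero α hlam, halfCgfDeriv_zero α hlam, mul_zero, sub_zero, sub_zero] at htay

/-- Expand `e^{sx} - 1 - sx` by Taylor's formula and exchange integrals by Tonelli. The inner
`x`-integral is `Γ(2 - α)` times the second derivative of `halfCgf`, so the outer one rebuilds
`halfCgf`. No case `α = 1` arises. -/
theorem lintegral_exp_sub_one_sub_tempered {α lam s : ℝ} (hα : 0 < α) (hα2 : α < 2)
    (hlam : 0 < lam) (hs : s < lam) :
    ∫⁻ x in Set.Ioi (0 : ℝ),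
      ENNReal.ofReal ((Real.exp (s * x) - 1 - s * x) * (Real.exp (-lam * x) * x ^ (-1 - α))) =
      ENNReal.ofReal (Real.Gamma (2 - α) * halfCgf α lam s) := by
  have hseg : ∀ r ∈ Set.Icc (0 : ℝ) 1, r * s < lam := fun r hr => by
    rcases le_total 0 s with h | h <;> nlinarith [hr.1, hr.2]
  have hG := Real.Gamma_pos_of_pos (show 0 < 2 - α by linarith)
  have hw : ∀ x ∈ Set.Ioi (0 : ℝ), 0 ≤ Real.exp (-lam * x) * x ^ (-1 - α) := fun x hx =>
    mul_nonneg (Real.exp_nonneg _) (Real.rpow_nonneg (le_of_lt hx) _)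
  have h1 : ∀ x ∈ Set.Ioi (0 : ℝ),
      ENNReal.ofReal ((Real.exp (s * x) - 1 - s * x) * (Real.exp (-lam * x) * x ^ (-1 - α))) =
      ∫⁻ r in Set.Ioc (0 : ℝ) 1, ENNReal.ofReal ((1 - r) * s ^ 2) *
        ENNReal.ofReal (x ^ 2 * Real.exp (r * s * x) * (Real.exp (-lam * x) * x ^ (-1 - α))) := by
    intro x hx
    rw [ENNReal.ofReal_mul' (hw x hx), ← lintegral_taylor_exp, ← lintegral_mul_const _ (by fun_prop)]
    refine setLIntegral_congr_fun measurableSet_Ioc fun r hr => ?_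
    have h0 : 0 ≤ (1 - r) * s ^ 2 := mul_nonneg (by linarith [hr.2]) (sq_nonneg s)
    rw [← ENNReal.ofReal_mul' (hw x hx), ← ENNReal.ofReal_mul h0, ← mul_assoc r s x]
    congr 1
    ring
  rw [setLIntegral_congr_fun measurableSet_Ioi h1, lintegral_lintegral_swap]
  · rw [mul_comm, ENNReal.ofReal_mul' hG.le, ← (taylor_halfCgf hα hlam hs).2,
      ← lintegral_mul_const' _ _ ENNReal.ofReal_ne_top]
    refine setLIntegral_congr_fun measurableSet_Ioc fun r hr => ?_
    have h0 : 0 ≤ (1 - r) * s ^ 2 := mul_nonneg (by linarith [hr.2]) (sq_nonneg s)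
    rw [lintegral_const_mul _ (by fun_prop),
      lintegral_sq_mul_exp_tempered hα2 (hseg r ⟨hr.1.le, hr.2⟩), ← ENNReal.ofReal_mul h0,
      ← ENNReal.ofReal_mul' hG.le]
    congr 1
    ring
  · unfold Function.uncurry
    fun_prop

/-! ### Regularity and strict convexity of `PhiH`. -/

/-- The two signs of jumps contribute separately. At `α = 1` the linear terms `u` and `-u` of the
halves cancel. -/
theorem PhiH_eq_halfCgf (α lp lm u : ℝ) :
    PhiH α lp lm u =
      (halfCgf α lp u + halfCgf α lm (-u)) / (lp ^ (α - 2) + lm ^ (α - 2)) := by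
  by_cases h1 : α = 1
  · simp only [PhiH, halfCgf, h1, if_true]
    rw [show (1 : ℝ) - 2 = -1 by norm_num, Real.rpow_neg_one, Real.rpow_neg_one, sub_neg_eq_add]
    congr 1
    ring
  · simp only [PhiH, halfCgf, h1, if_false, sub_neg_eq_add]
    rw [add_div, add_div, add_div, div_div, div_div, div_div, div_div]
    generalize lp ^ (α - 2) + lm ^ (α - 2) = S
    generalize (α - 1) * S = T
    ring_nf

theorem PhiH_zero {α lp lm : ℝ} (hlp : 0 < lp) (hlm : 0 < lm) : PhiH α lp lm 0 = 0 := by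
  rw [PhiH_eq_halfCgf, neg_zero, halfCgf_zero α hlp, halfCgf_zero α hlm, add_zero, zero_div]

theorem continuous_PhiH {α lp lm : ℝ} (hα : 0 < α) (hlp : 0 < lp) (hlm : 0 < lm) :
    Continuous (PhiH α lp lm) := by
  have h1 := continuous_halfCgf hα hlp
  have h2 := (continuous_halfCgf hα hlm).comp continuous_neg
  exact ((h1.add h2).div_const _).congr fun u => (PhiH_eq_halfCgf α lp lm u).symm

/-- The derivative of `PhiH`. -/
noncomputable def PhiHDeriv (α lp lm u : ℝ) : ℝ :=
  (halfCgfDeriv α lp u - halfCgfDeriv α lm (-u)) / (lp ^ (α - 2) + lm ^ (α - 2))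

theorem hasDerivAt_PhiH {α lp lm u : ℝ} (hα : 0 < α) (hlp : 0 < lp) (hlm : 0 < lm)
    (hu : u ∈ Set.Ioo (-lm) lp) : HasDerivAt (PhiH α lp lm) (PhiHDeriv α lp lm u) u := by
  have h1 := hasDerivAt_halfCgf hα hlp hu.2
  have h2 := (hasDerivAt_halfCgf hα hlm (s := -u) (by linarith [hu.1])).comp u (hasDerivAt_neg u)
  rw [show PhiH α lp lm = _ from funext (PhiH_eq_halfCgf α lp lm)]
  refine ((h1.add h2).div_const _).congr_deriv ?_
  rw [PhiHDeriv]
  ring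

theorem hasDerivAt_PhiHDeriv {α lp lm u : ℝ} (hlp : 0 < lp) (hlm : 0 < lm)
    (hu : u ∈ Set.Ioo (-lm) lp) : HasDerivAt (PhiHDeriv α lp lm)
      (((lp - u) ^ (α - 2) + (lm + u) ^ (α - 2)) / (lp ^ (α - 2) + lm ^ (α - 2))) u := by
  have h1 := hasDerivAt_halfCgfDeriv (α := α) hlp hu.2
  have h2 := (hasDerivAt_halfCgfDeriv (α := α) hlm (s := -u) (by linarith [hu.1])).comp u
    (hasDerivAt_neg u)
  refine ((h1.sub h2).div_const _).congr_deriv ?_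
  rw [sub_neg_eq_add]
  ring

theorem deriv2_PhiH {α lp lm u : ℝ} (hα : 0 < α) (hlp : 0 < lp) (hlm : 0 < lm)
    (hu : u ∈ Set.Ioo (-lm) lp) : deriv (deriv (PhiH α lp lm)) u =
      ((lp - u) ^ (α - 2) + (lm + u) ^ (α - 2)) / (lp ^ (α - 2) + lm ^ (α - 2)) := by
  have h : deriv (PhiH α lp lm) =ᶠ[𝓝 u] PhiHDeriv α lp lm := by
    filter_upwards [isOpen_Ioo.mem_nhds hu] with w hw
    exact (hasDerivAt_PhiH hα hlp hlm hw).deriv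
  rw [h.deriv_eq, (hasDerivAt_PhiHDeriv hlp hlm hu).deriv]

theorem strictConvexOn_PhiH {α lp lm : ℝ} (hα : 0 < α) (hlp : 0 < lp) (hlm : 0 < lm) :
    StrictConvexOn ℝ (Set.Icc (-lm) lp) (PhiH α lp lm) := by
  refine strictConvexOn_of_deriv2_pos (convex_Icc _ _)
    (continuous_PhiH hα hlp hlm).continuousOn fun u hu => ?_
  rw [interior_Icc] at hu
  rw [Function.iterate_succ, Function.iterate_one, Function.comp_apply,
    deriv2_PhiH hα hlp hlm hu]
  have h1 : 0 < lp - u := sub_pos.2 hu.2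
  have h2 : 0 < lm + u := by linarith [hu.1]
  positivity

/-! ### The Lévy measure and its integrals. -/

theorem stdScale_pos {α lp lm : ℝ} (hα2 : α < 2) (hlp : 0 < lp) (hlm : 0 < lm) :
    0 < stdScale α lp lm := by
  have hG := Real.Gamma_pos_of_pos (show 0 < 2 - α by linarith)
  unfold stdScale
  positivity

theorem ctsLevyDensity_nonneg {α lp lm cp cm : ℝ} (hcp : 0 ≤ cp) (hcm : 0 ≤ cm) (x : ℝ) :
    0 ≤ ctsLevyDensity α lp lm cp cm x := by
  unfold ctsLevyDensity
  split_ifs <;> positivity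

@[fun_prop]
theorem measurable_ctsLevyDensity (α lp lm cp cm : ℝ) :
    Measurable (ctsLevyDensity α lp lm cp cm) := by
  unfold ctsLevyDensity
  refine Measurable.ite measurableSet_Ioi (by fun_prop)
    (Measurable.ite measurableSet_Iio (by fun_prop) (by fun_prop))

/-- Reflecting the negative half-line reduces a two-sided integral to the one-sided ones. -/
theorem lintegral_mul_ctsLevyDensity {α lp lm c : ℝ} (hc : 0 ≤ c) {g : ℝ → ℝ}
    (hg : Measurable g) :
    ∫⁻ x, ENNReal.ofReal (g x * ctsLevyDensity α lp lm c c x) =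
      ENNReal.ofReal c *
        ((∫⁻ x in Set.Ioi 0, ENNReal.ofReal (g x * (Real.exp (-lp * x) * x ^ (-1 - α)))) +
        ∫⁻ x in Set.Ioi 0, ENNReal.ofReal (g (-x) * (Real.exp (-lm * x) * x ^ (-1 - α)))) := by
  set A : ℝ → ℝ≥0∞ := (Set.Ioi 0).indicator
    fun x => ENNReal.ofReal (g x * (Real.exp (-lp * x) * x ^ (-1 - α))) with hA
  set B : ℝ → ℝ≥0∞ := (Set.Ioi 0).indicator
    fun x => ENNReal.ofReal (g (-x) * (Real.exp (-lm * x) * x ^ (-1 - α))) with hB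
  have hAm : Measurable A := Measurable.indicator (by fun_prop) measurableSet_Ioi
  have hBm : Measurable B := Measurable.indicator (by fun_prop) measurableSet_Ioi
  have heq : ∀ x, ENNReal.ofReal (g x * ctsLevyDensity α lp lm c c x) =
      ENNReal.ofReal c * (A x + B (-x)) := by
    intro x
    rcases lt_trichotomy x 0 with hx | rfl | hx
    · have h1 : x ∉ Set.Ioi (0 : ℝ) := by simpa using hx.le
      have h2 : -x ∈ Set.Ioi (0 : ℝ) := by simpa using hx
      rw [hA, hB, Set.indicator_of_notMem h1, Set.indicator_of_mem h2, zero_add, neg_neg,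
        ← ENNReal.ofReal_mul hc, ctsLevyDensity, if_neg hx.not_gt, if_pos hx, abs_of_neg hx]
      congr 1
      ring
    · simp [hA, hB, ctsLevyDensity]
    · have h1 : -x ∉ Set.Ioi (0 : ℝ) := by simpa using hx.le
      have h2 : x ∈ Set.Ioi (0 : ℝ) := hx
      rw [hA, hB, Set.indicator_of_notMem h1, Set.indicator_of_mem h2, add_zero,
        ← ENNReal.ofReal_mul hc, ctsLevyDensity, if_pos hx]
      congr 1
      ring
  simp_rw [heq]
  rw [lintegral_const_mul _ (by fun_prop), lintegral_add_left hAm, lintegral_neg_eq_self B,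
    lintegral_indicator measurableSet_Ioi, lintegral_indicator measurableSet_Ioi]

theorem lintegral_exp_sub_one_sub_mul_levy {α lp lm s : ℝ} (hα : 0 < α) (hα2 : α < 2)
    (hlp : 0 < lp) (hlm : 0 < lm) (hs : s ∈ Set.Ioo (-lm) lp) :
    ∫⁻ x, ENNReal.ofReal ((Real.exp (s * x) - 1 - s * x) *
        ctsLevyDensity α lp lm (stdScale α lp lm) (stdScale α lp lm) x) =
      ENNReal.ofReal (PhiH α lp lm s) := by
  have hG := Real.Gamma_pos_of_pos (show 0 < 2 - α by linarith)
  have hS : 0 < lp ^ (α - 2) + lm ^ (α - 2) := by positivity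
  have hm := lintegral_exp_sub_one_sub_tempered hα hα2 hlm (s := -s) (by linarith [hs.1])
  have hnp := (taylor_halfCgf hα hlp hs.2).1
  have hnm := (taylor_halfCgf hα hlm (s := -s) (by linarith [hs.1])).1
  simp only [neg_mul_comm s] at hm
  rw [lintegral_mul_ctsLevyDensity (stdScale_pos hα2 hlp hlm).le (by fun_prop),
    lintegral_exp_sub_one_sub_tempered hα hα2 hlp hs.2, hm,
    ← ENNReal.ofReal_add (by positivity) (by positivity),
    ← ENNReal.ofReal_mul (stdScale_pos hα2 hlp hlm).le, PhiH_eq_halfCgf, stdScale]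
  congr 1
  field_simp

theorem PhiH_nonneg {α lp lm s : ℝ} (hα : 0 < α) (hlp : 0 < lp) (hlm : 0 < lm)
    (hs : s ∈ Set.Ioo (-lm) lp) : 0 ≤ PhiH α lp lm s := by
  have hnp := (taylor_halfCgf hα hlp hs.2).1
  have hnm := (taylor_halfCgf hα hlm (s := -s) (by linarith [hs.1])).1
  rw [PhiH_eq_halfCgf]
  positivity

theorem lintegral_sq_mul_levy_lt_top {α lp lm : ℝ} (hα2 : α < 2) (hlp : 0 < lp) (hlm : 0 < lm) :
    ∫⁻ x, ENNReal.ofReal (x ^ 2 *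
      ctsLevyDensity α lp lm (stdScale α lp lm) (stdScale α lp lm) x) < ⊤ := by
  have hp := lintegral_sq_mul_exp_tempered hα2 hlp
  have hm := lintegral_sq_mul_exp_tempered hα2 hlm
  simp only [zero_mul, Real.exp_zero, mul_one] at hp hm
  rw [lintegral_mul_ctsLevyDensity (stdScale_pos hα2 hlp hlm).le (by fun_prop)]
  simp only [even_two.neg_pow]
  rw [hp, hm]
  exact ENNReal.mul_lt_top ENNReal.ofReal_lt_top
    (ENNReal.add_lt_top.2 ⟨ENNReal.ofReal_lt_top, ENNReal.ofReal_lt_top⟩)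

/-- The Lévy measure of `stdCTS(α, lp, lm)`, multiplied by `v`. -/
noncomputable def levyMeasure (α lp lm v : ℝ) : Measure ℝ :=
  volume.withDensity fun x => ENNReal.ofReal
    (v * ctsLevyDensity α lp lm (stdScale α lp lm) (stdScale α lp lm) x)

section LevyMeasure

variable {α lp lm v : ℝ}

theorem integral_levyMeasure {E : Type*} [NormedAddCommGroup E] [NormedSpace ℝ E]
    (hα2 : α < 2) (hlp : 0 < lp) (hlm : 0 < lm) (hv : 0 < v) (g : ℝ → E) :
    ∫ x, g x ∂(levyMeasure α lp lm v) =
      v • ∫ x, ctsLevyDensity α lp lm (stdScale α lp lm) (stdScale α lp lm) x • g x := by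
  have hc := (stdScale_pos hα2 hlp hlm).le
  rw [levyMeasure, integral_withDensity_eq_integral_toReal_smul (by fun_prop)
    (ae_of_all _ fun x => ENNReal.ofReal_lt_top), ← integral_smul]
  refine integral_congr_ae (ae_of_all _ fun x => ?_)
  simp only
  rw [ENNReal.toReal_ofReal (mul_nonneg hv.le (ctsLevyDensity_nonneg hc hc x)), mul_smul]

theorem integrable_levyMeasure (hα2 : α < 2) (hlp : 0 < lp) (hlm : 0 < lm) (hv : 0 < v)
    {g : ℝ → ℝ} (hg : Measurable g) (hg0 : ∀ x, 0 ≤ g x)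
    (h : ∫⁻ x, ENNReal.ofReal (g x *
      ctsLevyDensity α lp lm (stdScale α lp lm) (stdScale α lp lm) x) < ⊤) :
    Integrable g (levyMeasure α lp lm v) := by
  have hc := (stdScale_pos hα2 hlp hlm).le
  refine (lintegral_ofReal_ne_top_iff_integrable hg.aestronglyMeasurable (ae_of_all _ hg0)).1 ?_
  rw [levyMeasure, lintegral_withDensity_eq_lintegral_mul _ (by fun_prop) (by fun_prop)]
  have heq : ∀ x, ((fun x => ENNReal.ofReal
      (v * ctsLevyDensity α lp lm (stdScale α lp lm) (stdScale α lp lm) x)) *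
      fun x => ENNReal.ofReal (g x)) x = ENNReal.ofReal v * ENNReal.ofReal (g x *
      ctsLevyDensity α lp lm (stdScale α lp lm) (stdScale α lp lm) x) := by
    intro x
    rw [Pi.mul_apply, ENNReal.ofReal_mul hv.le, ENNReal.ofReal_mul (hg0 x)]
    ring
  simp_rw [heq]
  rw [lintegral_const_mul _ (by fun_prop)]
  exact ENNReal.mul_ne_top ENNReal.ofReal_ne_top h.ne

theorem exp_sub_one_sub_nonneg (y : ℝ) : 0 ≤ Real.exp y - 1 - y := by
  linarith [Real.add_one_le_exp y]

theorem integrable_sq_levyMeasure (hα2 : α < 2) (hlp : 0 < lp) (hlm : 0 < lm) (hv : 0 < v) :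
    Integrable (fun x : ℝ => x ^ 2) (levyMeasure α lp lm v) :=
  integrable_levyMeasure hα2 hlp hlm hv (by fun_prop) (fun x => sq_nonneg x)
    (lintegral_sq_mul_levy_lt_top hα2 hlp hlm)

theorem integrable_exp_levyMeasure (hα : 0 < α) (hα2 : α < 2) (hlp : 0 < lp) (hlm : 0 < lm)
    (hv : 0 < v) {s : ℝ} (hs : s ∈ Set.Ioo (-lm) lp) :
    Integrable (fun x : ℝ => Real.exp (s * x) - 1 - s * x) (levyMeasure α lp lm v) := by
  refine integrable_levyMeasure hα2 hlp hlm hv (by fun_prop) (fun x => exp_sub_one_sub_nonneg _) ?_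
  rw [lintegral_exp_sub_one_sub_mul_levy hα hα2 hlp hlm hs]
  exact ENNReal.ofReal_lt_top

theorem integral_exp_levyMeasure (hα : 0 < α) (hα2 : α < 2) (hlp : 0 < lp) (hlm : 0 < lm)
    (hv : 0 < v) {s : ℝ} (hs : s ∈ Set.Ioo (-lm) lp) :
    ∫ x, (Real.exp (s * x) - 1 - s * x) ∂(levyMeasure α lp lm v) = v * PhiH α lp lm s := by
  have hc := (stdScale_pos hα2 hlp hlm).le
  rw [integral_levyMeasure hα2 hlp hlm hv, smul_eq_mul]
  congr 1
  simp only [smul_eq_mul, mul_comm (ctsLevyDensity _ _ _ _ _ _)]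
  rw [integral_eq_lintegral_of_nonneg_ae, lintegral_exp_sub_one_sub_mul_levy hα hα2 hlp hlm hs,
    ENNReal.toReal_ofReal (PhiH_nonneg hα hlp hlm hs)]
  · exact ae_of_all _ fun x =>
      mul_nonneg (exp_sub_one_sub_nonneg _) (ctsLevyDensity_nonneg hc hc x)
  · exact Measurable.aestronglyMeasurable (by fun_prop)

end LevyMeasure

/-! ### Exponential moments of the conditional law. -/

section ExponentialMoments

variable {α lp lm : ℝ}

theorem stdScale_scale (hα2 : α < 2) (hlp : 0 < lp) (hlm : 0 < lm) {w : ℝ} (hw : 0 < w) :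
    stdScale α (lp * w) (lm * w) = w ^ (2 - α) * stdScale α lp lm := by
  have hG := Real.Gamma_pos_of_pos (show 0 < 2 - α by linarith)
  have hS : 0 < lp ^ (α - 2) + lm ^ (α - 2) := by positivity
  rw [stdScale, stdScale, Real.mul_rpow hlp.le hw.le, Real.mul_rpow hlm.le hw.le,
    show 2 - α = -(α - 2) by ring, Real.rpow_neg hw.le]
  have : 0 < w ^ (α - 2) := by positivity
  rw [← add_mul, show -(α - 2) = 2 - α by ring]
  field_simp

/-- With `w = √v`, of the factor `w ^ 3` one `w` is the Jacobian of `x ↦ w x`; the remaining `w ^ 2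
= v` multiplies the Lévy measure. -/
theorem ctsLevyDensity_scale (hα2 : α < 2) (hlp : 0 < lp) (hlm : 0 < lm) {w : ℝ} (hw : 0 < w)
    (x : ℝ) :
    ctsLevyDensity α (lp * w) (lm * w) (stdScale α (lp * w) (lm * w))
        (stdScale α (lp * w) (lm * w)) x =
      w ^ 3 * ctsLevyDensity α lp lm (stdScale α lp lm) (stdScale α lp lm) (w * x) := by
  have key : w ^ (2 - α) = w ^ 3 * w ^ (-1 - α) := by
    rw [← Real.rpow_natCast w 3, ← Real.rpow_add hw]
    congr 1
    push_cast
    ring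
  rw [stdScale_scale hα2 hlp hlm hw, key]
  generalize stdScale α lp lm = c
  rcases lt_trichotomy x 0 with hx | rfl | hx
  · have hwx : w * x < 0 := mul_neg_of_pos_of_neg hw hx
    rw [ctsLevyDensity, ctsLevyDensity, if_neg hx.not_gt, if_pos hx, if_neg hwx.not_gt,
      if_pos hwx, abs_mul, abs_of_pos hw, Real.mul_rpow hw.le (abs_nonneg x)]
    ring_nf
  · simp [ctsLevyDensity]
  · have hwx : 0 < w * x := mul_pos hw hx
    rw [ctsLevyDensity, ctsLevyDensity, if_pos hx, if_pos hwx, Real.mul_rpow hw.le hx.le]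
    ring_nf

theorem charFun_scale_of_isStdCTS (hα2 : α < 2) (hlp : 0 < lp) (hlm : 0 < lm) {v : ℝ} (hv : 0 < v)
    {ρ : Measure ℝ} (hρ : IsStdCTS α (lp * √v) (lm * √v) ρ) (t : ℝ) :
    charFun (ρ.map (√v * ·)) t = Complex.exp (∫ x,
      (Complex.exp (Complex.I * t * x) - 1 - Complex.I * t * x) ∂(levyMeasure α lp lm v)) := by
  have hw : 0 < √v := Real.sqrt_pos.2 hv
  rw [charFun_map_mul, hρ.2, ctsCharExponent, integral_levyMeasure hα2 hlp hlm hv]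
  congr 1
  simp only [Complex.ofReal_zero, mul_zero, zero_add]
  have hsub := Measure.integral_comp_mul_left (fun y : ℝ =>
    ctsLevyDensity α lp lm (stdScale α lp lm) (stdScale α lp lm) y •
      (Complex.exp (Complex.I * t * y) - 1 - Complex.I * t * y)) √v
  have hv2 : v = √v * √v := (Real.mul_self_sqrt hv.le).symm
  have h3 : v = √v ^ 3 * |(√v)⁻¹| := by
    rw [abs_of_pos (inv_pos.2 hw)]
    field_simp
    nlinarith
  conv_rhs => rw [h3]
  rw [mul_smul, ← hsub, ← integral_smul]
  refine integral_congr_ae (ae_of_all _ fun x => ?_)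
  simp only [ctsLevyDensity_scale hα2 hlp hlm hw, Complex.real_smul]
  push_cast
  have hE : Complex.I * (√v * t) * x = Complex.I * t * (√v * x) := by ring
  rw [hE]
  ring

theorem lintegral_exp_of_isStdCTS_of_mem_Ioo (hα : 0 < α) (hα2 : α < 2) (hlp : 0 < lp)
    (hlm : 0 < lm) {v : ℝ} (hv : 0 < v) {ρ : Measure ℝ}
    (hρ : IsStdCTS α (lp * √v) (lm * √v) ρ) {s : ℝ} (hs : s ∈ Set.Ioo (-lm) lp) :
    ∫⁻ x, ENNReal.ofReal (Real.exp (s * x)) ∂(ρ.map (√v * ·)) =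
      ENNReal.ofReal (Real.exp (v * PhiH α lp lm s)) := by
  have := hρ.1
  have : IsProbabilityMeasure (ρ.map (√v * ·)) := Measure.isProbabilityMeasure_map (by fun_prop)
  -- The interval is open, so the exponent can be enlarged slightly; this is the room that uniform
  -- integrability requires.
  obtain ⟨p, hp, hps⟩ : ∃ p : ℝ, 1 < p ∧ p * s ∈ Set.Ioo (-lm) lp := by
    have hc : Tendsto (fun p : ℝ => p * s) (𝓝[>] 1) (𝓝 s) := by
      have : Continuous fun p : ℝ => p * s := by fun_prop
      simpa using (this.tendsto 1).mono_left nhdsWithin_le_nhds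
    have h1 := hc.eventually (isOpen_Ioo.mem_nhds hs)
    obtain ⟨p, h, hp⟩ := (h1.and self_mem_nhdsWithin).exists
    exact ⟨p, hp, h⟩
  rw [lintegral_exp_of_charFun_eq (integrable_sq_levyMeasure hα2 hlp hlm hv)
    (charFun_scale_of_isStdCTS hα2 hlp hlm hv hρ) hp
    (integrable_exp_levyMeasure hα hα2 hlp hlm hv hs)
    (integrable_exp_levyMeasure hα hα2 hlp hlm hv hps),
    integral_exp_levyMeasure hα hα2 hlp hlm hv hs]

/-- Approach `s` along `θ n * s`, which lies in the open interval because `0` does. Fatou makes the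
moment at `s` finite; then `1 + e^{sx}` dominates and the limit is an equality. -/
theorem lintegral_exp_eq_of_mem_Icc {ρ : Measure ℝ} [IsProbabilityMeasure ρ] {f : ℝ → ℝ}
    (hlp : 0 < lp) (hlm : 0 < lm) (hf : Continuous f)
    (h : ∀ s ∈ Set.Ioo (-lm) lp, ∫⁻ x, ENNReal.ofReal (Real.exp (s * x)) ∂ρ =
      ENNReal.ofReal (Real.exp (f s))) {s : ℝ} (hs : s ∈ Set.Icc (-lm) lp) :
    ∫⁻ x, ENNReal.ofReal (Real.exp (s * x)) ∂ρ = ENNReal.ofReal (Real.exp (f s)) := by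
  let θ : ℕ → ℝ := fun n => 1 - 1 / ((n : ℝ) + 2)
  have hθ0 : ∀ n, 0 ≤ θ n ∧ θ n < 1 := by
    intro n
    have hn : (0 : ℝ) < (n : ℝ) + 2 := by positivity
    have h1 : 1 / ((n : ℝ) + 2) ≤ 1 := by rw [div_le_one hn]; linarith [n.cast_nonneg (α := ℝ)]
    have h2 : 0 < 1 / ((n : ℝ) + 2) := by positivity
    constructor <;> simp only [θ] <;> linarith
  have hθ : Tendsto θ atTop (𝓝 1) := by
    have h1 : Tendsto (fun n : ℕ => (n : ℝ) + 2) atTop atTop :=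
      tendsto_natCast_atTop_atTop.atTop_add tendsto_const_nhds
    have h2 := (tendsto_const_nhds (x := (1 : ℝ))).div_atTop h1
    simpa [θ] using (tendsto_const_nhds (x := (1 : ℝ))).sub h2
  have hmem : ∀ n, θ n * s ∈ Set.Ioo (-lm) lp := by
    intro n
    obtain ⟨h0, h1⟩ := hθ0 n
    constructor <;> rcases le_total 0 s with hs0 | hs0 <;> nlinarith [hs.1, hs.2]
  have hpt : ∀ x : ℝ, Tendsto (fun n => ENNReal.ofReal (Real.exp (θ n * s * x))) atTop
      (𝓝 (ENNReal.ofReal (Real.exp (s * x)))) := by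
    intro x
    have hc : Continuous fun r : ℝ => ENNReal.ofReal (Real.exp (r * s * x)) :=
      ENNReal.continuous_ofReal.comp (by fun_prop)
    simpa [Function.comp_def] using (hc.tendsto 1).comp hθ
  have hval : Tendsto (fun n => ∫⁻ x, ENNReal.ofReal (Real.exp (θ n * s * x)) ∂ρ) atTop
      (𝓝 (ENNReal.ofReal (Real.exp (f s)))) := by
    have hc : Continuous fun r : ℝ => ENNReal.ofReal (Real.exp (f (r * s))) :=
      ENNReal.continuous_ofReal.comp (by fun_prop)
    have := (hc.tendsto 1).comp hθ
    rw [one_mul] at this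
    exact this.congr fun n => (h _ (hmem n)).symm
  have hfin : ∫⁻ x, ENNReal.ofReal (Real.exp (s * x)) ∂ρ ≤ ENNReal.ofReal (Real.exp (f s)) := by
    have := lintegral_liminf_le (μ := ρ) (u := atTop) (f := fun n x => ENNReal.ofReal (Real.exp (θ n * s * x)))
      fun n => measurable_ofReal_exp_mul _
    rw [hval.liminf_eq] at this
    simpa only [(hpt _).liminf_eq] using this
  refine tendsto_nhds_unique ?_ hval
  refine tendsto_lintegral_of_dominated_convergence
    (fun x => 1 + ENNReal.ofReal (Real.exp (s * x))) (fun n => measurable_ofReal_exp_mul _)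
    (fun n => ae_of_all _ fun x => ?_) ?_ (ae_of_all _ hpt)
  · beta_reduce
    rw [← ENNReal.ofReal_one, ← ENNReal.ofReal_add zero_le_one (Real.exp_nonneg _)]
    refine ENNReal.ofReal_le_ofReal ?_
    obtain ⟨h0, h1⟩ := hθ0 n
    rcases le_total 0 (s * x) with hx | hx
    · have : Real.exp (θ n * s * x) ≤ Real.exp (s * x) := Real.exp_le_exp.2 (by nlinarith)
      linarith
    · have : Real.exp (θ n * s * x) ≤ 1 := Real.exp_le_one_iff.2 (by nlinarith)
      linarith [Real.exp_pos (s * x)]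
  · rw [lintegral_add_left measurable_const]
    refine (ENNReal.add_lt_top.2 ⟨by simp, hfin.trans_lt ENNReal.ofReal_lt_top⟩).ne

/-- Since `α < 2`, the term `(lp - u) ^ (α - 2)` explodes at `lp`, although `PhiH` itself stays
finite there. -/
theorem tendsto_deriv2_PhiH (hα : 0 < α) (hα2 : α < 2) (hlp : 0 < lp) (hlm : 0 < lm) :
    Tendsto (deriv (deriv (PhiH α lp lm))) (𝓝[<] lp) atTop := by
  have hS : 0 < lp ^ (α - 2) + lm ^ (α - 2) := by positivity
  have h1 : Tendsto (fun u : ℝ => lp - u) (𝓝[<] lp) (𝓝[>] 0) := by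
    refine tendsto_nhdsWithin_iff.2 ⟨?_, ?_⟩
    · have : Continuous fun u : ℝ => lp - u := by fun_prop
      simpa using (this.tendsto lp).mono_left nhdsWithin_le_nhds
    · filter_upwards [self_mem_nhdsWithin] with u hu using sub_pos.2 (Set.mem_Iio.1 hu)
  have h2 : Tendsto (fun u : ℝ => (lp - u) ^ (α - 2) / (lp ^ (α - 2) + lm ^ (α - 2)))
      (𝓝[<] lp) atTop :=
    ((tendsto_rpow_neg_nhdsGT_zero (by linarith)).comp h1).atTop_div_const hS
  refine tendsto_atTop_mono' _ ?_ h2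
  filter_upwards [Ioo_mem_nhdsLT (show -lm < lp by linarith)] with u hu
  rw [deriv2_PhiH hα hlp hlm hu]
  have : 0 < lm + u := by linarith [hu.1]
  gcongr
  have : 0 < (lm + u) ^ (α - 2) := by positivity
  linarith

theorem integrable_exp_iff {ρ : Measure ℝ} (s : ℝ) :
    Integrable (fun x => Real.exp (s * x)) ρ ↔
      ∫⁻ x, ENNReal.ofReal (Real.exp (s * x)) ∂ρ ≠ ⊤ :=
  (lintegral_ofReal_ne_top_iff_integrable (by fun_prop)
    (ae_of_all _ fun x => Real.exp_nonneg _)).symm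

/-- A finite moment at some `s > lp` would, by convexity of the set of finite moments, put `lp` in
its interior. The cumulant generating function would be analytic at `lp`, with a finite limit of
second derivatives; but left of `lp` it equals `v Φ_H`, whose second derivative diverges. -/
theorem lintegral_exp_eq_top_of_lt (hα : 0 < α) (hα2 : α < 2) (hlp : 0 < lp) (hlm : 0 < lm)
    {v : ℝ} (hv : 0 < v) {ρ : Measure ℝ}
    (h : ∀ s ∈ Set.Ioo (-lm) lp, ∫⁻ x, ENNReal.ofReal (Real.exp (s * x)) ∂ρ =
      ENNReal.ofReal (Real.exp (v * PhiH α lp lm s))) {s : ℝ} (hs : lp < s) :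
    ∫⁻ x, ENNReal.ofReal (Real.exp (s * x)) ∂ρ = ⊤ := by
  by_contra hcon
  have h0 : (0 : ℝ) ∈ integrableExpSet id ρ :=
    (integrable_exp_iff 0).2 (by rw [h 0 ⟨by linarith, hlp⟩]; exact ENNReal.ofReal_ne_top)
  have h1 : s ∈ integrableExpSet id ρ := (integrable_exp_iff s).2 hcon
  have hint : lp ∈ interior (integrableExpSet id ρ) :=
    mem_interior.2 ⟨Set.Ioo 0 s, Set.Ioo_subset_Icc_self.trans
      (convex_integrableExpSet.ordConnected.out h0 h1), isOpen_Ioo, hlp, hs⟩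
  have hcgf : ∀ u ∈ Set.Ioo (-lm) lp, cgf id ρ u = v * PhiH α lp lm u := by
    intro u hu
    have hm : mgf id ρ u = Real.exp (v * PhiH α lp lm u) := by
      simp only [mgf, id]
      rw [integral_eq_lintegral_of_nonneg_ae (ae_of_all _ fun x => Real.exp_nonneg _)
        (by fun_prop), h u hu, ENNReal.toReal_ofReal (Real.exp_nonneg _)]
    rw [cgf, hm, Real.log_exp]
  have hlim : Tendsto (deriv (deriv (cgf id ρ))) (𝓝[<] lp) (𝓝 (deriv (deriv (cgf id ρ)) lp)) :=
    ((analyticAt_cgf hint).deriv.deriv.continuousAt.tendsto).mono_left nhdsWithin_le_nhds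
  refine not_tendsto_nhds_of_tendsto_atTop ?_ _ hlim
  refine ((tendsto_deriv2_PhiH hα hα2 hlp hlm).const_mul_atTop hv).congr' ?_
  filter_upwards [Ioo_mem_nhdsLT (show -lm < lp by linarith)] with u hu
  have he : cgf id ρ =ᶠ[𝓝 u] fun u => v * PhiH α lp lm u := by
    filter_upwards [isOpen_Ioo.mem_nhds hu] with w hw using hcgf w hw
  have he2 : deriv (fun u => v * PhiH α lp lm u) = fun u => v * deriv (PhiH α lp lm) u :=
    funext fun u => deriv_const_mul_field v
  rw [he.deriv.deriv_eq, he2, deriv_const_mul_field]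

theorem PhiH_neg (u : ℝ) : PhiH α lp lm (-u) = PhiH α lm lp u := by
  rw [PhiH_eq_halfCgf, PhiH_eq_halfCgf, neg_neg, add_comm, add_comm (lp ^ _)]

/-- The left end point reduces to the right one by reflecting the law and exchanging `lp` with `lm`.
-/
theorem lintegral_exp_eq_top_of_notMem (hα : 0 < α) (hα2 : α < 2) (hlp : 0 < lp) (hlm : 0 < lm)
    {v : ℝ} (hv : 0 < v) {ρ : Measure ℝ}
    (h : ∀ s ∈ Set.Ioo (-lm) lp, ∫⁻ x, ENNReal.ofReal (Real.exp (s * x)) ∂ρ =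
      ENNReal.ofReal (Real.exp (v * PhiH α lp lm s))) {s : ℝ} (hs : s ∉ Set.Icc (-lm) lp) :
    ∫⁻ x, ENNReal.ofReal (Real.exp (s * x)) ∂ρ = ⊤ := by
  rcases lt_or_ge lp s with hs1 | hs1
  · exact lintegral_exp_eq_top_of_lt hα hα2 hlp hlm hv h hs1
  · have hs2 : lm < -s := by
      by_contra hcon
      exact hs ⟨by linarith, hs1⟩
    have hneg : ∀ u : ℝ, ∫⁻ x, ENNReal.ofReal (Real.exp (u * x)) ∂(ρ.map Neg.neg) =
        ∫⁻ x, ENNReal.ofReal (Real.exp (-u * x)) ∂ρ := by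
      intro u
      rw [lintegral_map (measurable_ofReal_exp_mul u) measurable_neg]
      simp only [neg_mul_comm]
    have := lintegral_exp_eq_top_of_lt hα hα2 hlm hlp hv (ρ := ρ.map Neg.neg) (fun u hu => by
      rw [hneg, h (-u) ⟨by linarith [hu.2], by linarith [hu.1]⟩, PhiH_neg]) hs2
    rwa [hneg, neg_neg] at this

/-- Exponential moments of `√v X` for `X ∼ stdCTS(α, lp √v, lm √v)`. -/
theorem lintegral_exp_of_isStdCTS (hα : 0 < α) (hα2 : α < 2) (hlp : 0 < lp)
    (hlm : 0 < lm) {v : ℝ} (hv : 0 < v) {ρ : Measure ℝ}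
    (hρ : IsStdCTS α (lp * √v) (lm * √v) ρ) (s : ℝ) [Decidable (s ∈ Set.Icc (-lm) lp)] :
    ∫⁻ x, ENNReal.ofReal (Real.exp (s * (√v * x))) ∂ρ =
      if s ∈ Set.Icc (-lm) lp then ENNReal.ofReal (Real.exp (v * PhiH α lp lm s)) else ⊤ := by
  have := hρ.1
  have : IsProbabilityMeasure (ρ.map (√v * ·)) := Measure.isProbabilityMeasure_map (by fun_prop)
  have h := fun s hs => lintegral_exp_of_isStdCTS_of_mem_Ioo hα hα2 hlp hlm hv hρ (s := s) hs
  rw [← lintegral_map (f := fun x => ENNReal.ofReal (Real.exp (s * x))) (g := (√v * ·))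
    (measurable_ofReal_exp_mul s) (by fun_prop)]
  split_ifs with hs
  · exact lintegral_exp_eq_of_mem_Icc (f := fun s => v * PhiH α lp lm s) hlp hlm
      (continuous_const.mul (continuous_PhiH hα hlp hlm)) h hs
  · exact lintegral_exp_eq_top_of_notMem hα hα2 hlp hlm hv h hs

end ExponentialMoments

/-! ### Fundamental strips and the gamma law. -/

theorem mem_fundamentalStrip_iff {Ω : Type*} [MeasurableSpace Ω] {P : Measure Ω} {Z : Ω → ℝ}
    {u : ℂ} : u ∈ fundamentalStrip P Z ↔
      ∫⁻ ω, ENNReal.ofReal (Real.exp (u.re * Z ω)) ∂P < ⊤ := by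
  have h : ∀ ω, ‖Complex.exp (u * (Z ω : ℂ))‖ₑ = ENNReal.ofReal (Real.exp (u.re * Z ω)) := by
    intro ω
    rw [← ofReal_norm, Complex.norm_exp, Complex.re_mul_ofReal]
  simp only [fundamentalStrip, Set.mem_ofPred_eq, h]

theorem measurable_gammaPDF (a b : ℝ) : Measurable (gammaPDF a b) :=
  (measurable_gammaPDFReal a b).ennreal_ofReal

/-- Exponential tilting of the gamma density of rate `b` gives a multiple of the one of rate `b -
s`. -/
theorem lintegral_exp_gammaMeasure_of_lt {a b s : ℝ} (ha : 0 < a) (hb : 0 < b) (hs : s < b) :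
    ∫⁻ x, ENNReal.ofReal (Real.exp (s * x)) ∂(gammaMeasure a b) < ⊤ := by
  have hpos : 0 < b - s := sub_pos.2 hs
  rw [gammaMeasure, lintegral_withDensity_eq_lintegral_mul _
    (measurable_gammaPDF a b) (measurable_ofReal_exp_mul s)]
  have heq : ∀ x, (gammaPDF a b * fun x => ENNReal.ofReal (Real.exp (s * x))) x =
      ENNReal.ofReal ((b / (b - s)) ^ a) * gammaPDF a (b - s) x := by
    intro x
    rw [Pi.mul_apply]
    rcases lt_or_ge x 0 with hx | hx
    · rw [gammaPDF_of_neg hx, gammaPDF_of_neg hx, zero_mul, mul_zero]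
    · rw [gammaPDF_of_nonneg hx, gammaPDF_of_nonneg hx, ← ENNReal.ofReal_mul' (Real.exp_nonneg _),
        ← ENNReal.ofReal_mul (by positivity), Real.div_rpow hb.le hpos.le, mul_assoc, ← Real.exp_add,
        show -(b * x) + s * x = -((b - s) * x) by ring]
      congr 1
      have : 0 < (b - s) ^ a := by positivity
      field_simp
  simp_rw [heq]
  rw [lintegral_const_mul _ (measurable_gammaPDF a _),
    lintegral_gammaPDF_eq_one ha hpos, mul_one]
  exact ENNReal.ofReal_lt_top

/-- For `s ≥ b` the exponential factors multiply to at least `1`, and no power of `x` is integrable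
on the whole half-line. -/
theorem lintegral_exp_gammaMeasure_of_le {a b s : ℝ} (ha : 0 < a) (hb : 0 < b) (hs : b ≤ s) :
    ∫⁻ x, ENNReal.ofReal (Real.exp (s * x)) ∂(gammaMeasure a b) = ⊤ := by
  have hG := Real.Gamma_pos_of_pos ha
  rw [gammaMeasure, lintegral_withDensity_eq_lintegral_mul _
    (measurable_gammaPDF a b) (measurable_ofReal_exp_mul s), eq_top_iff]
  have hinf : ∫⁻ x in Set.Ioi (0 : ℝ), ENNReal.ofReal (x ^ (a - 1)) = ⊤ := by
    by_contra hcon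
    refine not_integrableOn_Ioi_rpow (a - 1)
      ((lintegral_ofReal_ne_top_iff_integrable ?_ ?_).1 hcon)
    · exact Measurable.aestronglyMeasurable (by fun_prop)
    · exact (ae_restrict_iff' measurableSet_Ioi).2
        (ae_of_all _ fun x hx => Real.rpow_nonneg (le_of_lt hx) _)
  calc (⊤ : ℝ≥0∞) = ENNReal.ofReal (b ^ a / Real.Gamma a) *
        ∫⁻ x in Set.Ioi (0 : ℝ), ENNReal.ofReal (x ^ (a - 1)) := by
        rw [hinf, ENNReal.mul_top]
        exact (ENNReal.ofReal_pos.2 (by positivity)).ne'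
    _ = ∫⁻ x in Set.Ioi (0 : ℝ), ENNReal.ofReal (b ^ a / Real.Gamma a) *
        ENNReal.ofReal (x ^ (a - 1)) := (lintegral_const_mul _ (by fun_prop)).symm
    _ ≤ ∫⁻ x in Set.Ioi (0 : ℝ),
        (gammaPDF a b * fun x => ENNReal.ofReal (Real.exp (s * x))) x := by
        refine setLIntegral_mono' measurableSet_Ioi fun x hx => ?_
        have hx0 : 0 < x := hx
        rw [Pi.mul_apply, gammaPDF_of_nonneg hx0.le, ← ENNReal.ofReal_mul (by positivity),
          ← ENNReal.ofReal_mul (by positivity), mul_assoc _ (Real.exp _), ← Real.exp_add]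
        refine ENNReal.ofReal_le_ofReal (le_mul_of_one_le_right (by positivity) ?_)
        rw [Real.one_le_exp_iff]
        nlinarith
    _ ≤ _ := setLIntegral_le_lintegral _ _

theorem fundamentalStrip_of_gamma {Ω : Type*} [MeasurableSpace Ω] {P : Measure Ω} {V : Ω → ℝ}
    (hV : Measurable V) {a b : ℝ} (ha : 0 < a) (hb : 0 < b) (h : P.map V = gammaMeasure a b) :
    fundamentalStrip P V = {u : ℂ | u.re < b} := by
  ext u
  rw [mem_fundamentalStrip_iff, ← lintegral_map (f := fun x => ENNReal.ofReal (Real.exp (u.re * x)))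
    (measurable_ofReal_exp_mul _) hV, h]
  change _ ↔ u.re < b
  refine ⟨fun hu => ?_, lintegral_exp_gammaMeasure_of_lt ha hb⟩
  by_contra hcon
  exact hu.ne (lintegral_exp_gammaMeasure_of_le ha hb (not_lt.1 hcon))

/-! ### Integrating over the mixing variable. -/

open Classical in
theorem lintegral_exp_mixedTS {Ω : Type*} [MeasurableSpace Ω] {P : Measure Ω}
    [IsProbabilityMeasure P] {μ β α lp lm : ℝ} (hα : 0 < α) (hα2 : α < 2) (hlp : 0 < lp)
    (hlm : 0 < lm) {V X Y : Ω → ℝ} (hY : IsMixedTS P μ β α lp lm V X Y) (s : ℝ) :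
    ∫⁻ ω, ENNReal.ofReal (Real.exp (s * Y ω)) ∂P =
      if s ∈ Set.Icc (-lm) lp then ENNReal.ofReal (Real.exp (s * μ)) *
        ∫⁻ ω, ENNReal.ofReal (Real.exp ((β * s + PhiH α lp lm s) * V ω)) ∂P else ⊤ := by
  have hV := hY.measurable_V
  have hX := hY.measurable_X
  have hFm : Measurable fun q : ℝ × ℝ =>
      ENNReal.ofReal (Real.exp (s * (μ + β * q.1 + √q.1 * q.2))) := by fun_prop
  have h1 : ∫⁻ ω, ENNReal.ofReal (Real.exp (s * Y ω)) ∂P =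
      ∫⁻ v, ∫⁻ x, ENNReal.ofReal (Real.exp (s * (μ + β * v + √v * x)))
        ∂(condDistrib X V P v) ∂(P.map V) := by
    -- Disintegration: the joint law of `(V, X)` is the law of `V` composed with the conditional law
    -- of `X`.
    rw [← Measure.lintegral_compProd (μ := P.map V) (κ := condDistrib X V P) hFm,
      compProd_map_condDistrib hX.aemeasurable, lintegral_map hFm (hV.prodMk hX)]
    refine lintegral_congr_ae ?_
    filter_upwards [hY.eq_Y] with ω hω
    rw [hω]
  have hpos : ∀ᵐ v ∂(P.map V), 0 < v :=
    (ae_map_iff hV.aemeasurable measurableSet_Ioi).2 hY.pos_V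
  have h2 : ∀ᵐ v ∂(P.map V), ∫⁻ x, ENNReal.ofReal (Real.exp (s * (μ + β * v + √v * x)))
        ∂(condDistrib X V P v) = ENNReal.ofReal (Real.exp (s * (μ + β * v))) *
        if s ∈ Set.Icc (-lm) lp then ENNReal.ofReal (Real.exp (v * PhiH α lp lm s)) else ⊤ := by
    filter_upwards [hpos, hY.cond_X] with v hv hρ
    rw [← lintegral_exp_of_isStdCTS hα hα2 hlp hlm hv hρ s, ← lintegral_const_mul _ (by fun_prop)]
    refine lintegral_congr fun x => ?_
    rw [← ENNReal.ofReal_mul (Real.exp_nonneg _), ← Real.exp_add, ← mul_add]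
  rw [h1, lintegral_congr_ae h2]
  split_ifs with hs
  · rw [lintegral_map (by fun_prop) hV, ← lintegral_const_mul _ (by fun_prop)]
    refine lintegral_congr fun ω => ?_
    rw [← ENNReal.ofReal_mul (Real.exp_nonneg _), ← ENNReal.ofReal_mul (Real.exp_nonneg _),
      ← Real.exp_add, ← Real.exp_add]
    congr 2
    ring
  -- The constant `⊤` integrates to `⊤` because the law of `V` has nonzero mass.
  · have := Measure.isProbabilityMeasure_map (μ := P) hV.aemeasurable
    have htop : ∀ v : ℝ, ENNReal.ofReal (Real.exp (s * (μ + β * v))) * ⊤ = ⊤ := fun v =>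
      ENNReal.mul_top (ENNReal.ofReal_pos.2 (Real.exp_pos _)).ne'
    simp [htop]

theorem mem_fundamentalStrip_mixedTS {Ω : Type*} [MeasurableSpace Ω] {P : Measure Ω}
    [IsProbabilityMeasure P] {μ β α lp lm b : ℝ} (hα : 0 < α) (hα2 : α < 2) (hlp : 0 < lp)
    (hlm : 0 < lm) {V X Y : Ω → ℝ} (hY : IsMixedTS P μ β α lp lm V X Y)
    (hV : fundamentalStrip P V = {u : ℂ | u.re < b}) (u : ℂ) :
    u ∈ fundamentalStrip P Y ↔
      u.re ∈ Set.Icc (-lm) lp ∧ β * u.re + PhiH α lp lm u.re < b := by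
  have hVr : ∀ c : ℝ, ∫⁻ ω, ENNReal.ofReal (Real.exp (c * V ω)) ∂P < ⊤ ↔ c < b := by
    intro c
    have h := mem_fundamentalStrip_iff (P := P) (Z := V) (u := (c : ℂ))
    rw [hV, Complex.ofReal_re] at h
    exact h.symm
  rw [mem_fundamentalStrip_iff, lintegral_exp_mixedTS hα hα2 hlp hlm hY]
  split_ifs with hs
  · rw [← hVr]
    refine ⟨fun h => ⟨hs, ?_⟩, fun h => ENNReal.mul_lt_top ENNReal.ofReal_lt_top h.2⟩
    exact ENNReal.lt_top_of_mul_ne_top_right h.ne (ENNReal.ofReal_pos.2 (Real.exp_pos _)).ne'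
  · simp [hs]

/-! ### The equation `β u + Φ_H(u) = b`. -/

section Equation

variable {β α lp lm b : ℝ}

theorem strictConvexOn_linear_add_PhiH (hα : 0 < α) (hlp : 0 < lp) (hlm : 0 < lm) :
    StrictConvexOn ℝ (Set.Icc (-lm) lp) fun u => β * u + PhiH α lp lm u := by
  have h : ConvexOn ℝ (Set.Icc (-lm) lp) fun u : ℝ => β * u :=
    ((LinearMap.mul ℝ ℝ β).convexOn (convex_Icc _ _))
  exact h.add_strictConvexOn (strictConvexOn_PhiH hα hlp hlm)

theorem linear_add_PhiH_lt_max (hα : 0 < α) (hlp : 0 < lp) (hlm : 0 < lm) {x y z : ℝ}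
    (hx : x ∈ Set.Icc (-lm) lp) (hy : y ∈ Set.Icc (-lm) lp) (hxz : x < z) (hzy : z < y) :
    β * z + PhiH α lp lm z < max (β * x + PhiH α lp lm x) (β * y + PhiH α lp lm y) :=
  (strictConvexOn_linear_add_PhiH hα hlp hlm).lt_on_openSegment hx hy (hxz.trans hzy).ne
    (by rw [openSegment_eq_Ioo (hxz.trans hzy)]; exact ⟨hxz, hzy⟩)

/-- Convexity keeps the function below the larger of its values at `0` and `lp`, namely `0` and the
end value; both are less than `b`. -/
theorem linear_add_PhiH_lt_right (hα : 0 < α) (hlp : 0 < lp) (hlm : 0 < lm) (hb : 0 < b)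
    (h : β * lp + PhiH α lp lm lp < b) {u : ℝ} (hu : u ∈ Set.Icc 0 lp) :
    β * u + PhiH α lp lm u < b := by
  have h0 : β * 0 + PhiH α lp lm 0 = 0 := by rw [PhiH_zero hlp hlm]; ring
  rcases hu.1.eq_or_lt with rfl | hu0
  · rwa [h0]
  rcases hu.2.eq_or_lt with rfl | hu1
  · exact h
  · refine (linear_add_PhiH_lt_max hα hlp hlm ⟨by linarith, hlp.le⟩ ⟨by linarith, le_rfl⟩
      hu0 hu1).trans (max_lt ?_ h)
    rwa [h0]

/-- The intermediate value theorem gives a root `r`. Strict convexity on `[0, r]` keeps the function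
below `b` before `r`. For `u > r`, the value `b` at `r` lies strictly below the larger of `0` and
the value at `u`, so the latter exceeds `b`. -/
theorem exists_root_right (hα : 0 < α) (hlp : 0 < lp) (hlm : 0 < lm) (hb : 0 < b)
    (h : b < β * lp + PhiH α lp lm lp) :
    ∃ r ∈ Set.Ioo 0 lp, ∀ u ∈ Set.Icc 0 lp,
      (β * u + PhiH α lp lm u < b ↔ u < r) ∧ (β * u + PhiH α lp lm u = b ↔ u = r) := by
  have h0 : β * 0 + PhiH α lp lm 0 = 0 := by rw [PhiH_zero hlp hlm]; ring
  have hc : Continuous fun u => β * u + PhiH α lp lm u :=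
    (by fun_prop : Continuous fun u : ℝ => β * u).add (continuous_PhiH hα hlp hlm)
  obtain ⟨r, hr, hrb⟩ := intermediate_value_Ioo hlp.le hc.continuousOn
    (show b ∈ Set.Ioo _ _ from ⟨h0.trans_lt hb, h⟩)
  simp only at hrb
  have hrI : r ∈ Set.Icc (-lm) lp := ⟨by linarith [hr.1], hr.2.le⟩
  have hlt : ∀ u ∈ Set.Icc 0 lp, u < r → β * u + PhiH α lp lm u < b := by
    intro u hu hur
    rcases hu.1.eq_or_lt with rfl | hu0
    · rwa [h0]
    · refine (linear_add_PhiH_lt_max hα hlp hlm ⟨by linarith, hlp.le⟩ hrI hu0 hur).trans_le ?_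
      rw [h0, hrb, max_eq_right hb.le]
  have hgt : ∀ u ∈ Set.Icc 0 lp, r < u → b < β * u + PhiH α lp lm u := by
    intro u hu hur
    have := linear_add_PhiH_lt_max (β := β) hα hlp hlm (x := 0) ⟨by linarith, hlp.le⟩
      ⟨by linarith [hu.1], hu.2⟩ hr.1 hur
    rw [h0, hrb] at this
    exact (lt_max_iff.1 this).resolve_left hb.not_gt
  refine ⟨r, hr, fun u hu => ?_⟩
  rcases lt_trichotomy u r with hur | rfl | hur
  · have := hlt u hu hur
    exact ⟨iff_of_true this hur, iff_of_false this.ne hur.ne⟩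
  · exact ⟨iff_of_false hrb.not_lt (lt_irrefl _), iff_of_true hrb rfl⟩
  · have := hgt u hu hur
    exact ⟨iff_of_false this.not_gt hur.not_gt, iff_of_false this.ne' hur.ne'⟩

/-- The symmetry `u ↦ -u`, `β ↦ -β`, `lp ↔ lm` transfers every statement on `[0, lp]` to `[-lm, 0]`.
-/
theorem linear_add_PhiH_neg (u : ℝ) :
    -β * -u + PhiH α lm lp (-u) = β * u + PhiH α lp lm u := by
  rw [PhiH_neg]
  ring

theorem linear_add_PhiH_lt_left (hα : 0 < α) (hlp : 0 < lp) (hlm : 0 < lm) (hb : 0 < b)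
    (h : -β * lm + PhiH α lp lm (-lm) < b) {u : ℝ} (hu : u ∈ Set.Icc (-lm) 0) :
    β * u + PhiH α lp lm u < b := by
  rw [PhiH_neg] at h
  rw [← linear_add_PhiH_neg]
  exact linear_add_PhiH_lt_right hα hlm hlp hb h ⟨by linarith [hu.2], by linarith [hu.1]⟩

theorem exists_root_left (hα : 0 < α) (hlp : 0 < lp) (hlm : 0 < lm) (hb : 0 < b)
    (h : b < -β * lm + PhiH α lp lm (-lm)) :
    ∃ r ∈ Set.Ioo (-lm) 0, ∀ u ∈ Set.Icc (-lm) 0,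
      (β * u + PhiH α lp lm u < b ↔ r < u) ∧ (β * u + PhiH α lp lm u = b ↔ u = r) := by
  rw [PhiH_neg] at h
  obtain ⟨r, hr, hroot⟩ := exists_root_right hα hlm hlp hb h
  refine ⟨-r, ⟨by linarith [hr.2], by linarith [hr.1]⟩, fun u hu => ?_⟩
  have := hroot (-u) ⟨by linarith [hu.2], by linarith [hu.1]⟩
  rw [linear_add_PhiH_neg] at this
  rwa [neg_lt, neg_eq_iff_eq_neg] at this

end Equation

end MixedTS

/-! ### The four cases, glued at `0`. -/

theorem theorem1 {Ω : Type*} [MeasurableSpace Ω] (P : Measure Ω) [IsProbabilityMeasure P]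
    (μ β α lp lm b : ℝ) (hα0 : 0 < α) (hα2 : α < 2) (hlp : 0 < lp) (hlm : 0 < lm) (hb : 0 < b)
    (V X Y : Ω → ℝ) (hY : MixedTS.IsMixedTS P μ β α lp lm V X Y) :
    (∀ a : ℝ, 0 < a → P.map V = gammaMeasure a b →
      MixedTS.fundamentalStrip P V = {u : ℂ | u.re < b}) ∧
    (MixedTS.fundamentalStrip P V = {u : ℂ | u.re < b} →
      (max (-β * lm + MixedTS.PhiH α lp lm (-lm)) (β * lp + MixedTS.PhiH α lp lm lp) < b →
        MixedTS.fundamentalStrip P Y = {u : ℂ | -lm ≤ u.re ∧ u.re ≤ lp}) ∧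
      (-β * lm + MixedTS.PhiH α lp lm (-lm) < b ∧ b < β * lp + MixedTS.PhiH α lp lm lp →
        ∃ uₚ : ℝ, MixedTS.realSolutions β α lp lm b = {uₚ} ∧
          MixedTS.fundamentalStrip P Y = {u : ℂ | -lm ≤ u.re ∧ u.re < uₚ}) ∧
      (b < -β * lm + MixedTS.PhiH α lp lm (-lm) ∧ β * lp + MixedTS.PhiH α lp lm lp < b →
        ∃ uₘ : ℝ, MixedTS.realSolutions β α lp lm b = {uₘ} ∧
          MixedTS.fundamentalStrip P Y = {u : ℂ | uₘ < u.re ∧ u.re ≤ lp}) ∧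
      (b < min (-β * lm + MixedTS.PhiH α lp lm (-lm)) (β * lp + MixedTS.PhiH α lp lm lp) →
        ∃ uₘ uₚ : ℝ, uₘ < uₚ ∧ MixedTS.realSolutions β α lp lm b = {uₘ, uₚ} ∧
          MixedTS.fundamentalStrip P Y = {u : ℂ | uₘ < u.re ∧ u.re < uₚ})) := by
  refine ⟨fun a ha h => MixedTS.fundamentalStrip_of_gamma hY.measurable_V ha hb h, fun hV => ?_⟩
  have hmem := MixedTS.mem_fundamentalStrip_mixedTS hα0 hα2 hlp hlm hY hV
  refine ⟨fun h => ?_, fun ⟨hl, hr⟩ => ?_, fun ⟨hl, hr⟩ => ?_, fun h => ?_⟩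
  · obtain ⟨hl, hr⟩ := max_lt_iff.1 h
    ext u
    rw [hmem]
    refine ⟨fun hu => hu.1, fun hu => ⟨hu, ?_⟩⟩
    rcases le_total 0 u.re with h0 | h0
    · exact MixedTS.linear_add_PhiH_lt_right hα0 hlp hlm hb hr ⟨h0, hu.2⟩
    · exact MixedTS.linear_add_PhiH_lt_left hα0 hlp hlm hb hl ⟨hu.1, h0⟩
  · obtain ⟨r, hrI, hroot⟩ := MixedTS.exists_root_right hα0 hlp hlm hb hr
    have hleft := fun u hu => MixedTS.linear_add_PhiH_lt_left hα0 hlp hlm hb hl (u := u) hu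
    refine ⟨r, ?_, ?_⟩
    · ext u
      change (u ∈ Set.Icc (-lm) lp ∧ β * u + MixedTS.PhiH α lp lm u = b) ↔ u = r
      rcases le_total 0 u with h0 | h0
      · refine ⟨fun hu => ((hroot u ⟨h0, hu.1.2⟩).2).1 hu.2, ?_⟩
        rintro rfl
        exact ⟨⟨by linarith, hrI.2.le⟩, ((hroot u ⟨h0, hrI.2.le⟩).2).2 rfl⟩
      · refine ⟨fun hu => absurd hu.2 (hleft u ⟨hu.1.1, h0⟩).ne, ?_⟩
        rintro rfl
        exact absurd hrI.1 h0.not_gt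
    · ext u
      rw [hmem]
      change _ ↔ -lm ≤ u.re ∧ u.re < r
      rcases le_total 0 u.re with h0 | h0
      · refine ⟨fun hu => ⟨hu.1.1, ((hroot _ ⟨h0, hu.1.2⟩).1).1 hu.2⟩, fun hu => ?_⟩
        have hle : u.re ≤ lp := (hu.2.trans hrI.2).le
        exact ⟨⟨hu.1, hle⟩, ((hroot _ ⟨h0, hle⟩).1).2 hu.2⟩
      · exact ⟨fun hu => ⟨hu.1.1, h0.trans_lt hrI.1⟩,
          fun hu => ⟨⟨hu.1, by linarith⟩, hleft _ ⟨hu.1, h0⟩⟩⟩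
  · obtain ⟨r, hrI, hroot⟩ := MixedTS.exists_root_left hα0 hlp hlm hb hl
    have hright := fun u hu => MixedTS.linear_add_PhiH_lt_right hα0 hlp hlm hb hr (u := u) hu
    refine ⟨r, ?_, ?_⟩
    · ext u
      change (u ∈ Set.Icc (-lm) lp ∧ β * u + MixedTS.PhiH α lp lm u = b) ↔ u = r
      rcases le_total u 0 with h0 | h0
      · refine ⟨fun hu => ((hroot u ⟨hu.1.1, h0⟩).2).1 hu.2, ?_⟩
        rintro rfl
        exact ⟨⟨hrI.1.le, by linarith⟩, ((hroot u ⟨hrI.1.le, h0⟩).2).2 rfl⟩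
      · refine ⟨fun hu => absurd hu.2 (hright u ⟨h0, hu.1.2⟩).ne, ?_⟩
        rintro rfl
        exact absurd hrI.2 h0.not_gt
    · ext u
      rw [hmem]
      change _ ↔ r < u.re ∧ u.re ≤ lp
      rcases le_total u.re 0 with h0 | h0
      · refine ⟨fun hu => ⟨((hroot _ ⟨hu.1.1, h0⟩).1).1 hu.2, hu.1.2⟩, fun hu => ?_⟩
        have hle : -lm ≤ u.re := (hrI.1.trans hu.1).le
        exact ⟨⟨hle, hu.2⟩, ((hroot _ ⟨hle, h0⟩).1).2 hu.1⟩
      · exact ⟨fun hu => ⟨hrI.2.trans_le h0, hu.1.2⟩,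
          fun hu => ⟨⟨by linarith, hu.2⟩, hright _ ⟨h0, hu.2⟩⟩⟩
  · obtain ⟨hl, hr⟩ := lt_min_iff.1 h
    obtain ⟨r, hrI, hroot⟩ := MixedTS.exists_root_right hα0 hlp hlm hb hr
    obtain ⟨q, hqI, hqroot⟩ := MixedTS.exists_root_left hα0 hlp hlm hb hl
    refine ⟨q, r, hqI.2.trans hrI.1, ?_, ?_⟩
    · ext u
      change (u ∈ Set.Icc (-lm) lp ∧ β * u + MixedTS.PhiH α lp lm u = b) ↔ u = q ∨ u = r
      refine ⟨fun hu => ?_, ?_⟩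
      · rcases le_total 0 u with h0 | h0
        · exact Or.inr (((hroot u ⟨h0, hu.1.2⟩).2).1 hu.2)
        · exact Or.inl (((hqroot u ⟨hu.1.1, h0⟩).2).1 hu.2)
      · rintro (rfl | rfl)
        · exact ⟨⟨hqI.1.le, by linarith [hqI.2]⟩, ((hqroot u ⟨hqI.1.le, hqI.2.le⟩).2).2 rfl⟩
        · exact ⟨⟨by linarith [hrI.1], hrI.2.le⟩, ((hroot u ⟨hrI.1.le, hrI.2.le⟩).2).2 rfl⟩
    · ext u
      rw [hmem]
      change _ ↔ q < u.re ∧ u.re < r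
      rcases le_total 0 u.re with h0 | h0
      · refine ⟨fun hu => ⟨hqI.2.trans_le h0, ((hroot _ ⟨h0, hu.1.2⟩).1).1 hu.2⟩, fun hu => ?_⟩
        have hle : u.re ≤ lp := (hu.2.trans hrI.2).le
        exact ⟨⟨by linarith, hle⟩, ((hroot _ ⟨h0, hle⟩).1).2 hu.2⟩
      · refine ⟨fun hu => ⟨((hqroot _ ⟨hu.1.1, h0⟩).1).1 hu.2, h0.trans_lt hrI.1⟩, fun hu => ?_⟩
        have hle : -lm ≤ u.re := (hqI.1.trans hu.1).le
        exact ⟨⟨hle, by linarith⟩, ((hqroot _ ⟨hle, h0⟩).1).2 hu.1⟩
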